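/- Let $m,p,n\ge 1$ be integers with $p\mid m$, let $K\subset\mathbb C$ be a subfield closed under complex conjugation and containing all $m$th roots of unity, and let $G=G(m,p,n)\subset \mathrm{GL}(V)$, $V=K^n$, be the group of $n\times n$ matrices with exactly one non-zero entry in each row and column, these entries being $m$th roots of unity whose product $\pi$ satisfies $\pi^{m/p}=1$. Put $r=\dim(V/V^G)$. *Notation.* $K[x]=K[x_1,\dots,x_n]$ is the ring of polynomial functions on $V$, and $K[x,\theta]=K[x]\otimes\bigwedge V^*$ is the ring of polynomial differential forms, with $\theta_i=\mathrm dx_i$; $G$ acts contragrediently on both. For $\omega=\sum c_{\alpha,I}x^\alpha\theta_{i_1}\cdots\theta_{i_k}$ (where $I=\{i_1<\dots<i_k\}$) let $\partial_\omega=\sum\overline{c_{\alpha,I}}\,\partial_{x_1}^{\alpha_1}\cdots\partial_{x_n}^{\alpha_n}\,\partial_{\theta_{i_k}}\cdots\partial_{\theta_{i_1}}$, where $\partial_{\theta_i}$ is the interior product. Let $\mathcal I_G\subset K[x]$ (respectively $\mathcal J_G\subset K[x,\theta]$) be the ideal generated by the homogeneous (respectively bi-homogeneous) $G$-invariants of positive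 (respectively positive total) degree, and put $$\mathcal H_G=\{f\in K[x]:\partial_gf=0\ \ \forall g\in\mathcal I_G\},\qquad \mathcal{SH}_G=\{\eta\in K[x,\theta]:\partial_\omega\eta=0\ \ \forall\omega\in\mathcal J_G\}.$$ Let $\mathcal{SH}_G^{k}$ and $\mathcal{SH}_G^{i,k}$ be the components of $\theta$-degree $k$ and of ($x$-degree $i$, $\theta$-degree $k$). A superscript $\chi$ such as $\det$ or $\det^2$ denotes the subspace of elements $\eta$ with $\sigma\cdot\eta=\chi(\sigma)\eta$ for all $\sigma\in G$. Let $\Delta_G$ and $\Gamma_G$ be non-zero elements of $\mathcal H_G^{\det}$ and $\mathcal H_G^{\det^2}$ (unique up to scalars), and $\operatorname{Ann}\Gamma_G=\{g\in K[x]:\partial_g\Gamma_G=0\}$. Let $f_1,\dots,f_n$ be basic invariants of $G$ (homogeneous, algebraically independent, generating $K[x]^G$), and $\mathcal I_G'=\langle\partial_{x_j}f_i:1\le i,j\le n\rangle$. Finally let $\mathrm d_1,\dots,\mathrm d_n$ be generalized exterior derivatives of $G$ with co-exponents $e_1^*,\dots,e_n^*$: they are $G$-equivariant operators in $K[\partial_{x_1},\dots,\partial_{x_n},\theta_1,\dots,\theta_n]$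 ($\theta_i$ acting by left multiplication), $\mathrm d_i$ lowers $x$-degree by $e_i^*$ and raises $\theta$-degree by $1$, and the operators $\partial_{f_1}^{\alpha_1}\cdots\partial_{f_n}^{\alpha_n}\mathrm d_{i_1}\cdots\mathrm d_{i_k}$ ($\alpha_i\ge0$, $i_1<\dots<i_k$, $k\ge 0$) form a $K$-basis of the space of all $G$-equivariant operators in that algebra. **Statement.** Suppose that $G(m,p,n)$ is not one of $G(1,1,n)$, $G(2,1,n)$, $G(2,2,n)$, $G(m,p,1)$, $G(m,m,2)$, $G(m,1,n)$. Then: 1. $r=n$. 2. A non-zero $\Gamma_G\in\mathcal H_G^{\det^2}$ exists, and $\operatorname{Ann}\Gamma_G\ne\mathcal I_G'$ for every choice of $\Gamma_G$ and of the $f_i$. 3. The $r$-form component of the differential operator identity fails: $\mathcal{SH}_G^r\neq K[\partial_{x_1},\dots,\partial_{x_n}]\,(\mathcal{SH}_G^r)^{\det}$, and, for every choice of the $f_i$, $\mathrm d_i$ and $\Delta_G$, $\mathcal{SH}_G^r\ne\{\partial_g\mathrm d_{i_1}\cdots\mathrm d_{i_r}\Delta_G : g\in K[x],\ 1\le i_1,\dots,i_r\le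 n\}$. 4. The largest $i$ with $\mathcal{SH}_G^{i,r}\ne0$ and the largest $i$ with $(\mathcal{SH}_G^{i,r})^{\det}\neq0$ both exist, and the former is strictly larger than the latter. 5. The $r$-form component of the bi-degree bound fails: for every choice of the $f_i$, $\mathrm d_i$ and $\Delta_G$, it is not true that for all integers $i\ge0$ one has $\mathcal{SH}_G^{i,r}\neq0\iff i\le\deg\Delta_G-e_1^*-\cdots-e_r^*$. -/

import Mathlib

open scoped TensorProduct

noncomputable section

namespace SuperHarmonics

/-- The subfield `K` of `ℂ` is closed under complex conjugation. -/
class ConjClosed (K : Subfield ℂ) : Prop where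
  conj_mem : ∀ z ∈ K, (starRingEnd ℂ) z ∈ K

/-- Complex conjugation on `K`. -/
def conjK (K : Subfield ℂ) [hK : ConjClosed K] : K →+* K :=
  ((starRingEnd ℂ).comp K.subtype).codRestrict K (fun z => hK.conj_mem z z.2)

/-! ### The groups `G(m, p, n)` -/

/-- The pseudo-permutation matrix sending the `j`th standard basis vector to
`a j` times the `π j`th one. -/
def monomialMatrix {K : Subfield ℂ} {n : ℕ} (π : Equiv.Perm (Fin n)) (a : Fin n → K) :
    Matrix (Fin n) (Fin n) K :=
  Matrix.of fun i j => if i = π j then a j else 0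

theorem monomialMatrix_one {K : Subfield ℂ} {n : ℕ} :
    monomialMatrix (K := K) (1 : Equiv.Perm (Fin n)) (fun _ => 1) = 1 := by
  ext i j
  by_cases h : i = j
  · subst h; simp [monomialMatrix]
  · simp [monomialMatrix, h]

theorem monomialMatrix_mul {K : Subfield ℂ} {n : ℕ} (π ρ : Equiv.Perm (Fin n))
    (a b : Fin n → K) :
    monomialMatrix π a * monomialMatrix ρ b
      = monomialMatrix (π * ρ) (fun j => a (ρ j) * b j) := by
  ext i j
  by_cases h : i = π (ρ j)
  · simp [monomialMatrix, Matrix.mul_apply, h]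
  · simp [monomialMatrix, Matrix.mul_apply, h]

/-- The group `G(m, p, n)`: pseudo-permutation matrices whose non-zero entries are `m`th
roots of unity and have product a `(m/p)`th root of unity. It is meant for `p ∣ m`, `0 < m`,
and a field `K` that contains all complex `m`th roots of unity. -/
def Gmpn (K : Subfield ℂ) (m p n : ℕ) : Subgroup (GL (Fin n) K) where
  carrier := {A | ∃ (π : Equiv.Perm (Fin n)) (a : Fin n → K),
    (∀ i, a i ^ m = 1) ∧ (∏ i, a i) ^ (m / p) = 1 ∧
      (A : Matrix (Fin n) (Fin n) K) = monomialMatrix π a}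
  one_mem' := ⟨1, fun _ => 1, by simp, by simp, by simp [monomialMatrix_one]⟩
  mul_mem' := by
    rintro A B ⟨π, a, ha, ha', hA⟩ ⟨ρ, b, hb, hb', hB⟩
    refine ⟨π * ρ, fun j => a (ρ j) * b j, fun i => by simp [mul_pow, ha, hb], ?_, ?_⟩
    · rw [Finset.prod_mul_distrib, Equiv.prod_comp ρ a, mul_pow, ha', hb', one_mul]
    · rw [Units.val_mul, hA, hB, monomialMatrix_mul]
  inv_mem' := by
    rintro A ⟨π, a, ha, ha', hA⟩
    have hne : ∀ i, a i ≠ 0 := by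
      intro i h0
      have hm : m = 0 := by
        by_contra hm
        have h := ha i
        rw [h0, zero_pow hm] at h
        exact zero_ne_one h
      have hrow : ∀ k, (A : Matrix (Fin n) (Fin n) K) k i = 0 := by
        intro k
        rw [hA]
        simp [monomialMatrix, h0]
      have h1 : ((A⁻¹ : GL (Fin n) K) : Matrix (Fin n) (Fin n) K)
          * (A : Matrix (Fin n) (Fin n) K) = 1 := by
        rw [← Units.val_mul, inv_mul_cancel, Units.val_one]
      have h2 := congrFun (congrFun h1 i) i
      rw [Matrix.mul_apply] at h2
      simp [hrow] at h2
    refine ⟨π⁻¹, fun j => (a (π⁻¹ j))⁻¹, fun i => by rw [inv_pow, ha, inv_one], ?_, ?_⟩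
    · rw [Finset.prod_inv_distrib, Equiv.prod_comp π⁻¹ a, inv_pow, ha', inv_one]
    · have h1 : (A : Matrix (Fin n) (Fin n) K)
          * monomialMatrix π⁻¹ (fun j => (a (π⁻¹ j))⁻¹) = 1 := by
        rw [hA, monomialMatrix_mul, mul_inv_cancel, ← monomialMatrix_one]
        congr 1
        funext j
        exact mul_inv_cancel₀ (hne _)
      have h2 : ((A⁻¹ : GL (Fin n) K) : Matrix (Fin n) (Fin n) K)
          * (A : Matrix (Fin n) (Fin n) K) = 1 := by
        rw [← Units.val_mul, inv_mul_cancel, Units.val_one]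
      exact left_inv_eq_right_inv h2 h1

/-- The fixed space `V^G`, where `V = K^n`. -/
def fixedSpace {K : Subfield ℂ} {n : ℕ} (G : Subgroup (GL (Fin n) K)) :
    Submodule K (Fin n → K) where
  carrier := {v | ∀ σ ∈ G, (σ : Matrix (Fin n) (Fin n) K).mulVec v = v}
  add_mem' := fun {v w} hv hw σ hσ => by rw [Matrix.mulVec_add, hv σ hσ, hw σ hσ]
  zero_mem' := fun σ _ => Matrix.mulVec_zero _
  smul_mem' := fun c v hv σ hσ => by rw [Matrix.mulVec_smul, hv σ hσ]

/-- The rank `dim (V / V^G)`. -/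
def groupRank {K : Subfield ℂ} {n : ℕ} (G : Subgroup (GL (Fin n) K)) : ℕ :=
  Module.finrank K ((Fin n → K) ⧸ fixedSpace G)

/-! ### Polynomials: group action, differential operators, harmonics -/

/-- The contragredient action of a matrix on polynomial functions on `K^n`; the variable `X j`
is the `j`th coordinate function. -/
def polyAct {K : Subfield ℂ} {n : ℕ} (σ : GL (Fin n) K) :
    MvPolynomial (Fin n) K →ₐ[K] MvPolynomial (Fin n) K :=
  MvPolynomial.aeval fun j =>
    ∑ i, MvPolynomial.C (((σ⁻¹ : GL (Fin n) K) : Matrix (Fin n) (Fin n) K) j i)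
      * MvPolynomial.X i

/-- The `G`-invariant polynomials. -/
def polyInvariants {K : Subfield ℂ} {n : ℕ} (G : Subgroup (GL (Fin n) K)) :
    Subalgebra K (MvPolynomial (Fin n) K) where
  carrier := {g | ∀ σ ∈ G, polyAct σ g = g}
  mul_mem' := fun {f g} hf hg σ hσ => by rw [map_mul, hf σ hσ, hg σ hσ]
  add_mem' := fun {f g} hf hg σ hσ => by rw [map_add, hf σ hσ, hg σ hσ]
  algebraMap_mem' := fun c σ _ => (polyAct σ).commutes c

/-- `∂_{x_1}^{α_1} ⋯ ∂_{x_n}^{α_n}` on polynomials. -/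
def polyDiffMonomial {K : Subfield ℂ} {n : ℕ} (α : Fin n →₀ ℕ) :
    Module.End K (MvPolynomial (Fin n) K) :=
  (List.ofFn fun i : Fin n =>
    ((MvPolynomial.pderiv i : Derivation K _ _) :
      MvPolynomial (Fin n) K →ₗ[K] MvPolynomial (Fin n) K) ^ α i).prod

/-- `∂_g` for a polynomial `g`: substitute `∂_{x_i}` for `x_i` and conjugate the coefficients. -/
def polyDiff {K : Subfield ℂ} [ConjClosed K] {n : ℕ} (g : MvPolynomial (Fin n) K) :
    Module.End K (MvPolynomial (Fin n) K) :=
  ∑ α ∈ g.support, conjK K (g.coeff α) • polyDiffMonomial α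

/-- The coinvariant ideal `I_G`. -/
def coinvariantIdeal {K : Subfield ℂ} {n : ℕ} (G : Subgroup (GL (Fin n) K)) :
    Ideal (MvPolynomial (Fin n) K) :=
  Ideal.span {g | g ∈ polyInvariants G ∧ ∃ d, 0 < d ∧ g.IsHomogeneous d}

/-- The harmonics `H_G`. -/
def harmonics {K : Subfield ℂ} [ConjClosed K] {n : ℕ} (G : Subgroup (GL (Fin n) K)) :
    Submodule K (MvPolynomial (Fin n) K) where
  carrier := {f | ∀ g ∈ coinvariantIdeal G, polyDiff g f = 0}
  add_mem' := fun {f h} hf hh g hg => by rw [map_add, hf g hg, hh g hg, add_zero]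
  zero_mem' := fun _ _ => map_zero _
  smul_mem' := fun c f hf g hg => by rw [map_smul, hf g hg, smul_zero]

/-- The `det^s`-isotypic component of `H_G`. -/
def harmonicsDetPow {K : Subfield ℂ} [ConjClosed K] {n : ℕ} (G : Subgroup (GL (Fin n) K))
    (s : ℕ) : Submodule K (MvPolynomial (Fin n) K) where
  carrier := {f | f ∈ harmonics G ∧
    ∀ σ ∈ G, polyAct σ f = ((σ : Matrix (Fin n) (Fin n) K).det ^ s) • f}
  add_mem' := fun {f h} hf hh => ⟨add_mem hf.1 hh.1, fun σ hσ => by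
    rw [map_add, hf.2 σ hσ, hh.2 σ hσ, smul_add]⟩
  zero_mem' := ⟨zero_mem _, fun σ _ => by rw [map_zero, smul_zero]⟩
  smul_mem' := fun c f hf => ⟨Submodule.smul_mem _ c hf.1, fun σ hσ => by
    rw [map_smul, hf.2 σ hσ, smul_comm]⟩

/-- `Δ` is a Vandermondian `Δ_G`: a non-zero element of the `det`-isotypic component of `H_G`. -/
def IsVandermondian {K : Subfield ℂ} [ConjClosed K] {n : ℕ} (G : Subgroup (GL (Fin n) K))
    (Δ : MvPolynomial (Fin n) K) : Prop :=
  Δ ∈ harmonicsDetPow G 1 ∧ Δ ≠ 0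

/-- `Γ` is a choice of `Γ_G`: a non-zero element of the `det²`-isotypic component of `H_G`. -/
def IsGammaElement {K : Subfield ℂ} [ConjClosed K] {n : ℕ} (G : Subgroup (GL (Fin n) K))
    (Γ : MvPolynomial (Fin n) K) : Prop :=
  Γ ∈ harmonicsDetPow G 2 ∧ Γ ≠ 0

/-- `Ann F = {g : ∂_g F = 0}`. -/
def annihilatorSet {K : Subfield ℂ} [ConjClosed K] {n : ℕ} (F : MvPolynomial (Fin n) K) :
    Set (MvPolynomial (Fin n) K) :=
  {g | polyDiff g F = 0}

/-- `f_1, …, f_n` are basic invariants of `G`: homogeneous, algebraically independent, and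
generating the algebra of `G`-invariant polynomials. -/
structure IsBasicInvariants {K : Subfield ℂ} {n : ℕ} (G : Subgroup (GL (Fin n) K))
    (f : Fin n → MvPolynomial (Fin n) K) : Prop where
  homogeneous : ∀ i, ∃ d, (f i).IsHomogeneous d
  algebraicIndependent : AlgebraicIndependent K f
  adjoin_eq : Algebra.adjoin K (Set.range f) = polyInvariants G

/-- The ideal `I'_G` generated by all partial derivatives of the basic invariants. -/
def jacobianIdeal {K : Subfield ℂ} {n : ℕ} (f : Fin n → MvPolynomial (Fin n) K) :
    Ideal (MvPolynomial (Fin n) K) :=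
  Ideal.span (Set.range fun ij : Fin n × Fin n => MvPolynomial.pderiv ij.2 (f ij.1))

/-! ### Polynomial differential forms -/

/-- The ring `K[x_1, …, x_n, θ_1, …, θ_n] = S(V*) ⊗ ⋀ V*`, with `V*` written in the basis of
coordinate functions. -/
abbrev Forms (K : Subfield ℂ) (n : ℕ) : Type :=
  MvPolynomial (Fin n) K ⊗[K] ExteriorAlgebra K (Fin n → K)

/-- The element `θ_i`. -/
def theta {K : Subfield ℂ} {n : ℕ} (i : Fin n) : Forms K n :=
  1 ⊗ₜ[K] ExteriorAlgebra.ι K (Pi.single i 1)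

/-- The `K`-basis `x^α θ_{i_1} ⋯ θ_{i_k}`, for `I = {i_1 < ⋯ < i_k}`. -/
def formsBasis (K : Subfield ℂ) (n : ℕ) :
    Module.Basis ((Fin n →₀ ℕ) × Finset (Fin n)) K (Forms K n) :=
  (MvPolynomial.basisMonomials (Fin n) K).tensorProduct
    (Pi.basisFun K (Fin n)).ExteriorAlgebra

/-- The `θ`-linear operator `∂_{x_i}` on forms. -/
def dX {K : Subfield ℂ} {n : ℕ} (i : Fin n) : Module.End K (Forms K n) :=
  LinearMap.rTensor _ ((MvPolynomial.pderiv i : Derivation K _ _) :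
    MvPolynomial (Fin n) K →ₗ[K] MvPolynomial (Fin n) K)

/-- The `x`-linear operator `∂_{θ_i}` on forms, the interior product. -/
def dTheta {K : Subfield ℂ} {n : ℕ} (i : Fin n) : Module.End K (Forms K n) :=
  LinearMap.lTensor _
    (CliffordAlgebra.contractLeft (Q := (0 : QuadraticForm K (Fin n → K)))
      (LinearMap.proj i : (Fin n → K) →ₗ[K] K))

/-- `∂_{x_1}^{α_1} ⋯ ∂_{x_n}^{α_n} ∂_{θ_{i_k}} ⋯ ∂_{θ_{i_1}}` for `I = {i_1 < ⋯ < i_k}`. -/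
def formDiffMonomial {K : Subfield ℂ} {n : ℕ} (α : Fin n →₀ ℕ) (I : Finset (Fin n)) :
    Module.End K (Forms K n) :=
  (List.ofFn fun i : Fin n => (dX i : Module.End K (Forms K n)) ^ α i).prod *
    (((I.sort (· ≤ ·)).reverse).map dTheta).prod

/-- `∂_ω` for a form `ω`. -/
def formDiff {K : Subfield ℂ} [ConjClosed K] {n : ℕ} (ω : Forms K n) :
    Module.End K (Forms K n) :=
  ((formsBasis K n).repr ω).sum fun αI c => conjK K c • formDiffMonomial αI.1 αI.2

/-- The contragredient action on `V*`, in the basis of coordinate functions. -/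
def dualAct {K : Subfield ℂ} {n : ℕ} (σ : GL (Fin n) K) : (Fin n → K) →ₗ[K] (Fin n → K) :=
  Matrix.vecMulLinear ((σ⁻¹ : GL (Fin n) K) : Matrix (Fin n) (Fin n) K)

/-- The action on forms. -/
def formAct {K : Subfield ℂ} {n : ℕ} (σ : GL (Fin n) K) : Forms K n →ₐ[K] Forms K n :=
  Algebra.TensorProduct.map (polyAct σ) (ExteriorAlgebra.map (dualAct σ))

/-- Forms of `x`-degree `i` and `θ`-degree `k`. -/
def bidegree (K : Subfield ℂ) (n i k : ℕ) : Submodule K (Forms K n) :=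
  LinearMap.range (TensorProduct.mapIncl
    (MvPolynomial.homogeneousSubmodule (Fin n) K i) (⋀[K]^k (Fin n → K)))

/-- Forms of `θ`-degree `k`. -/
def thetaDegree (K : Subfield ℂ) (n k : ℕ) : Submodule K (Forms K n) :=
  LinearMap.range
    (LinearMap.lTensor (MvPolynomial (Fin n) K) (⋀[K]^k (Fin n → K)).subtype)

/-- The super coinvariant ideal `J_G`. -/
def superCoinvariantIdeal {K : Subfield ℂ} {n : ℕ} (G : Subgroup (GL (Fin n) K)) :
    TwoSidedIdeal (Forms K n) :=
  TwoSidedIdeal.span {ω | (∀ σ ∈ G, formAct σ ω = ω) ∧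
    ∃ i k, 0 < i + k ∧ ω ∈ bidegree K n i k}

/-- The super harmonics `SH_G`. -/
def superHarmonics {K : Subfield ℂ} [ConjClosed K] {n : ℕ} (G : Subgroup (GL (Fin n) K)) :
    Submodule K (Forms K n) where
  carrier := {η | ∀ ω ∈ superCoinvariantIdeal G, formDiff ω η = 0}
  add_mem' := fun {f h} hf hh g hg => by rw [map_add, hf g hg, hh g hg, add_zero]
  zero_mem' := fun _ _ => map_zero _
  smul_mem' := fun c f hf g hg => by rw [map_smul, hf g hg, smul_zero]

/-- The `det`-isotypic component of `SH_G`. -/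
def superHarmonicsDet {K : Subfield ℂ} [ConjClosed K] {n : ℕ} (G : Subgroup (GL (Fin n) K)) :
    Submodule K (Forms K n) where
  carrier := {η | η ∈ superHarmonics G ∧
    ∀ σ ∈ G, formAct σ η = (σ : Matrix (Fin n) (Fin n) K).det • η}
  add_mem' := fun {f h} hf hh => ⟨add_mem hf.1 hh.1, fun σ hσ => by
    rw [map_add, hf.2 σ hσ, hh.2 σ hσ, smul_add]⟩
  zero_mem' := ⟨zero_mem _, fun σ _ => by rw [map_zero, smul_zero]⟩
  smul_mem' := fun c f hf => ⟨Submodule.smul_mem _ c hf.1, fun σ hσ => by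
    rw [map_smul, hf.2 σ hσ, smul_comm]⟩

/-- `K[∂_{x_1}, …, ∂_{x_n}] M`, the span of all `∂_g η` with `g` a polynomial and `η ∈ M`. -/
def derivativeClosure {K : Subfield ℂ} [ConjClosed K] {n : ℕ} (M : Submodule K (Forms K n)) :
    Submodule K (Forms K n) :=
  Submodule.span K {ξ | ∃ (g : MvPolynomial (Fin n) K), ∃ η ∈ M,
    ξ = formDiff (g ⊗ₜ[K] (1 : ExteriorAlgebra K (Fin n → K))) η}

/-! ### Generalized exterior derivatives -/

/-- The operator algebra `K[∂_{x_1}, …, ∂_{x_n}, θ_1, …, θ_n]`, where `θ_i` acts by left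
multiplication. -/
def operatorAlgebra (K : Subfield ℂ) (n : ℕ) : Subalgebra K (Module.End K (Forms K n)) :=
  Algebra.adjoin K (Set.range (dX : Fin n → Module.End K (Forms K n)) ∪
    Set.range fun i : Fin n => LinearMap.mulLeft K (theta i : Forms K n))

/-- The `G`-equivariant operators in `K[∂_{x_1}, …, ∂_{x_n}, θ_1, …, θ_n]`. -/
def equivariantOperators {K : Subfield ℂ} {n : ℕ} (G : Subgroup (GL (Fin n) K)) :
    Submodule K (Module.End K (Forms K n)) where
  carrier := {P | P ∈ operatorAlgebra K n ∧ ∀ σ ∈ G, ∀ η, P (formAct σ η) = formAct σ (P η)}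
  add_mem' := fun {P Q} hP hQ => ⟨add_mem hP.1 hQ.1, fun σ hσ η => by
    rw [LinearMap.add_apply, LinearMap.add_apply, map_add, hP.2 σ hσ, hQ.2 σ hσ]⟩
  zero_mem' := ⟨zero_mem _, fun σ _ η => by simp⟩
  smul_mem' := fun c P hP => ⟨Subalgebra.smul_mem _ hP.1 c, fun σ hσ η => by
    rw [LinearMap.smul_apply, LinearMap.smul_apply, map_smul, hP.2 σ hσ]⟩

/-- `∂_{f_1}^{α_1} ⋯ ∂_{f_n}^{α_n} d_{i_1} ⋯ d_{i_k}` for `I = {i_1 < ⋯ < i_k}`. -/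
def operatorMonomial {K : Subfield ℂ} [ConjClosed K] {n : ℕ}
    (f : Fin n → MvPolynomial (Fin n) K) (d : Fin n → Module.End K (Forms K n))
    (αI : (Fin n →₀ ℕ) × Finset (Fin n)) : Module.End K (Forms K n) :=
  (List.ofFn fun i : Fin n =>
    formDiff (f i ⊗ₜ[K] (1 : ExteriorAlgebra K (Fin n → K))) ^ αI.1 i).prod *
    ((αI.2.sort (· ≤ ·)).map d).prod

/-- `d_1, …, d_n` are generalized exterior derivatives of `G` with co-exponents
`e_1, …, e_n`: `G`-equivariant operators in `K[∂_x, θ]`, the `i`th lowering `x`-degree by `e_i`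
and raising `θ`-degree by one, such that, for the given basic invariants `f`, the operators
`∂_{f_1}^{α_1} ⋯ ∂_{f_n}^{α_n} d_{i_1} ⋯ d_{i_k}` form a `K`-basis of the equivariant
operators. -/
structure IsGeneralizedExteriorDerivatives {K : Subfield ℂ} [ConjClosed K] {n : ℕ}
    (G : Subgroup (GL (Fin n) K)) (f : Fin n → MvPolynomial (Fin n) K)
    (d : Fin n → Module.End K (Forms K n)) (e : Fin n → ℕ) : Prop where
  equivariant : ∀ i, d i ∈ equivariantOperators G
  map_bidegree : ∀ i a k, ∀ η ∈ bidegree K n (a + e i) k, d i η ∈ bidegree K n a (k + 1)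
  map_low_degree : ∀ i a k, a < e i → ∀ η ∈ bidegree K n a k, d i η = 0
  linearIndependent : LinearIndependent K (operatorMonomial f d)
  span_eq : Submodule.span K (Set.range (operatorMonomial f d)) = equivariantOperators G

end SuperHarmonics

end

open SuperHarmonics

/-! Write `q = m / p`. The `n`-forms are `h θ_1 ⋯ θ_n` with `h` a polynomial, and everything reduces
to monomials. Up to scalars, the differentials of the invariants `∑ x_i^m` and `(x_1 ⋯ x_n)^q` are
1-forms with coefficients `x_i^(m-1)` and `∂_j (x_1 ⋯ x_n)^q`. Let `U` (`jacobianExponents`) be the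
upper set generated by the exponents of these monomials. Conversely, the `x`-exponents of every
bi-homogeneous invariant form of positive degree lie in `U` (`formCoeff_repr_ne_zero`). Hence `h θ_1
⋯ θ_n` is super harmonic iff no exponent of `h` lies in `U` (`tmul_topForm_mem_superHarmonics_iff`),
and `I'_G` is the monomial ideal of `U` for any choice of basic invariants.

Since `θ_1 ⋯ θ_n` has character `det⁻¹`, the `det` part of `SH_G^n` corresponds to `det²`
semi-invariants `h` supported off `U`. These are only the multiples of `(x_1 ⋯ x_n)^(q-2)`, or
constants if `q = 1`; truncated subtraction covers both cases (`eq_monomial_of_det_sq`). On the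
other hand, the exponent `(m-2, …, m-2, q-1, q-1)` is also outside `U`, dominates `(q-2, …, q-2)`,
and is strictly larger in its first entry (`lt_witnessExponent`); this is where the excluded
families matter. So the corresponding form has too large a degree and is not killed by
`∂_{x_1}^(q-2+1)`, an operator that kills the `det` part and, commuting with every `∂_g`, all its
derivatives. If `Ann Γ = I'_G`, the same monomial `x_1^(q-2+1)` would lie in `I'_G`, which it does
not.

For the bi-degree bound, `deg Δ ≤ n (q-1) + m (0 + ⋯ + (n-1))` and the co-exponents sum to at least
`m (0 + ⋯ + (n-1))`, plus `n` when `q ≠ 1`. Both estimates come from the characters and sign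
conditions on exponents, without explicit formulas for `Δ` or the `d_i`. The proposed bound is
therefore at most `n (q-2)`, below the degree of the witness. -/

noncomputable section

namespace SuperHarmonics

/-! ### Bases, top forms and monomial maps in the exterior algebra. -/

variable {K : Subfield ℂ} {n : ℕ}

/-- The basis of the exterior algebra of `K^n` by products of standard basis vectors. -/
def extBasis (K : Subfield ℂ) (n : ℕ) :
    Module.Basis (Finset (Fin n)) K (ExteriorAlgebra K (Fin n → K)) :=
  (Pi.basisFun K (Fin n)).ExteriorAlgebra

/-- The form `θ_1 ⋯ θ_n` in the exterior algebra. -/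
def topForm (K : Subfield ℂ) (n : ℕ) : ExteriorAlgebra K (Fin n → K) :=
  ExteriorAlgebra.ιMulti K n fun i => Pi.single i 1

theorem extBasis_eq_ιMulti {k : ℕ} (I : Finset (Fin n)) (hI : I.card = k) :
    extBasis K n I
      = ExteriorAlgebra.ιMulti K k fun j => Pi.single (I.orderEmbOfFin hI j) 1 := by
  rw [extBasis, ExteriorAlgebra.basis_apply_ofCard _ hI]
  simp only [ExteriorAlgebra.ιMulti_family]
  congr 1
  ext j
  simp [Set.powersetCard.ofFinEmbEquiv_symm_apply]

theorem extBasis_univ : extBasis K n Finset.univ = topForm K n := by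
  rw [extBasis_eq_ιMulti _ (Finset.card_fin n), topForm]
  congr 1
  ext1 j
  congr 1
  have := Finset.orderEmbOfFin_unique (s := (Finset.univ : Finset (Fin n))) (Finset.card_fin n)
    (f := id) (by simp) strictMono_id
  rw [← this]; rfl

theorem extBasis_empty : extBasis K n ∅ = 1 := by
  rw [extBasis_eq_ιMulti _ Finset.card_empty, ExteriorAlgebra.ιMulti_zero_apply]

theorem extBasis_singleton (i : Fin n) :
    extBasis K n {i} = ExteriorAlgebra.ι K (Pi.single i 1) := by
  rw [extBasis_eq_ιMulti _ (Finset.card_singleton i), ExteriorAlgebra.ιMulti_succ_apply]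
  simp

theorem topForm_ne_zero : topForm K n ≠ 0 := by
  rw [← extBasis_univ]; exact (extBasis K n).ne_zero _

theorem extBasis_map_diagonal {f : (Fin n → K) →ₗ[K] (Fin n → K)} {c : Fin n → K}
    (hf : ∀ i, f (Pi.single i 1) = c i • Pi.single i 1) (I : Finset (Fin n)) :
    ExteriorAlgebra.map f (extBasis K n I) = (∏ i ∈ I, c i) • extBasis K n I := by
  rw [extBasis_eq_ιMulti I rfl, ExteriorAlgebra.map_apply_ιMulti]
  have : (f ∘ fun j => Pi.single (I.orderEmbOfFin rfl j) (1 : K))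
      = fun j => c (I.orderEmbOfFin rfl j) • Pi.single (I.orderEmbOfFin rfl j) (1 : K) := by
    ext1 j; exact hf _
  rw [this, AlternatingMap.map_smul_univ]
  congr 1
  rw [← Finset.prod_coe_sort I]
  exact Equiv.prod_comp (I.orderIsoOfFin rfl).toEquiv fun x : I => c x

theorem extBasis_repr_map_diagonal {f : (Fin n → K) →ₗ[K] (Fin n → K)} {c : Fin n → K}
    (hf : ∀ i, f (Pi.single i 1) = c i • Pi.single i 1)
    (ξ : ExteriorAlgebra K (Fin n → K)) (I : Finset (Fin n)) :
    (extBasis K n).repr (ExteriorAlgebra.map f ξ) I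
      = (∏ i ∈ I, c i) * (extBasis K n).repr ξ I := by
  suffices h : (extBasis K n).coord I ∘ₗ (ExteriorAlgebra.map f).toLinearMap
      = (∏ i ∈ I, c i) • (extBasis K n).coord I by
    simpa using LinearMap.congr_fun h ξ
  refine (extBasis K n).ext fun J => ?_
  simp only [LinearMap.comp_apply, AlgHom.toLinearMap_apply, extBasis_map_diagonal hf,
    map_smul, LinearMap.smul_apply, Module.Basis.coord_apply, Module.Basis.repr_self,
    Finsupp.single_apply, smul_eq_mul]
  split_ifs with h
  · rw [h]
  · simp

/-- The scalar is the sign of the permutation that sorts the indices. -/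
theorem ιMulti_single_comp_eq {k : ℕ} (g : Fin k → Fin n) (hg : Function.Injective g)
    (I : Finset (Fin n)) (hI : Finset.univ.image g = I) :
    ∃ c : K, ExteriorAlgebra.ιMulti K k (fun j => Pi.single (g j) (1 : K))
      = c • extBasis K n I := by
  have hcard : I.card = k := by
    rw [← hI, Finset.card_image_of_injective _ hg, Finset.card_fin]
  have hmem : ∀ j, g j ∈ I := fun j => by rw [← hI]; simp
  let π : Equiv.Perm (Fin k) := (Equiv.ofBijective
    (fun j => (I.orderIsoOfFin hcard).symm ⟨g j, hmem j⟩) (by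
      rw [Fintype.bijective_iff_injective_and_card]
      refine ⟨fun x y h => hg ?_, rfl⟩
      simpa using h))
  refine ⟨(Equiv.Perm.sign π : ℤ), ?_⟩
  rw [extBasis_eq_ιMulti I hcard]
  have : (fun j => Pi.single (g j) (1 : K))
      = (fun j => Pi.single (I.orderEmbOfFin hcard j) (1 : K)) ∘ π := by
    ext1 j
    have : I.orderEmbOfFin hcard (π j) = g j := by
      have : ((I.orderIsoOfFin hcard) (π j) : Fin n) = g j := by simp [π]
      exact this
    simp [this]
  rw [this, AlternatingMap.map_perm, Units.smul_def, Int.cast_smul_eq_zsmul]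

/-- The transposition preserves the set `I`, so only the basis element of `I` itself contributes to
this coordinate, and there two factors are exchanged. This antisymmetry will exclude equal exponents
at two indices of `I`. -/
theorem extBasis_repr_map_swap {f : (Fin n → K) →ₗ[K] (Fin n → K)} {i j : Fin n} (hij : i ≠ j)
    (hf : ∀ k, f (Pi.single k 1) = Pi.single (Equiv.swap i j k) 1)
    (ξ : ExteriorAlgebra K (Fin n → K)) {I : Finset (Fin n)} (hi : i ∈ I) (hj : j ∈ I) :
    (extBasis K n).repr (ExteriorAlgebra.map f ξ) I = - (extBasis K n).repr ξ I := by
  suffices h : (extBasis K n).coord I ∘ₗ (ExteriorAlgebra.map f).toLinearMap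
      = - (extBasis K n).coord I by
    simpa using LinearMap.congr_fun h ξ
  refine (extBasis K n).ext fun J => ?_
  have hmap : ExteriorAlgebra.map f (extBasis K n J) = ExteriorAlgebra.ιMulti K J.card
      fun k => Pi.single (Equiv.swap i j (J.orderEmbOfFin rfl k)) (1 : K) := by
    rw [extBasis_eq_ιMulti J rfl, ExteriorAlgebra.map_apply_ιMulti]
    congr 1
    ext1 k; exact hf _
  simp only [LinearMap.comp_apply, AlgHom.toLinearMap_apply, LinearMap.neg_apply,
    Module.Basis.coord_apply]
  by_cases hJ : J = I
  · subst hJ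
    obtain ⟨a, ha⟩ : ∃ a, J.orderEmbOfFin rfl a = i := by
      have : i ∈ Set.range (J.orderEmbOfFin rfl) := by simpa using hi
      exact this
    obtain ⟨b, hb⟩ : ∃ b, J.orderEmbOfFin rfl b = j := by
      have : j ∈ Set.range (J.orderEmbOfFin rfl) := by simpa using hj
      exact this
    have hab : a ≠ b := by rintro rfl; exact hij (ha.symm.trans hb)
    have h2 : (fun k => Pi.single (Equiv.swap i j (J.orderEmbOfFin rfl k)) (1 : K))
        = (fun k => Pi.single (J.orderEmbOfFin rfl k) (1 : K)) ∘ Equiv.swap a b := by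
      ext1 k
      simp only [Function.comp_apply]
      rw [← ha, ← hb, ← Function.Injective.swap_apply (J.orderEmbOfFin rfl).injective]
    rw [hmap, h2, AlternatingMap.map_swap _ _ hab, ← extBasis_eq_ιMulti J rfl, map_neg,
      Finsupp.neg_apply]
  · obtain ⟨c, hc⟩ := ιMulti_single_comp_eq (K := K)
      (fun k => Equiv.swap i j (J.orderEmbOfFin rfl k))
      ((Equiv.swap i j).injective.comp (J.orderEmbOfFin rfl).injective) _ rfl
    rw [hmap, hc, map_smul, Finsupp.smul_apply, Module.Basis.repr_self, Module.Basis.repr_self,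
      Finsupp.single_eq_of_ne (Ne.symm hJ), Finsupp.single_eq_of_ne, smul_zero, neg_zero]
    intro hI
    apply hJ
    have himg : Finset.univ.image (fun k => Equiv.swap i j (J.orderEmbOfFin rfl k))
        = J.map (Equiv.swap i j).toEmbedding := by
      ext x
      simp only [Finset.mem_image, Finset.mem_univ, true_and, Finset.mem_map,
        Equiv.coe_toEmbedding]
      constructor
      · rintro ⟨k, rfl⟩; exact ⟨_, Finset.orderEmbOfFin_mem J rfl k, rfl⟩
      · rintro ⟨y, hy, rfl⟩
        have : y ∈ Set.range (J.orderEmbOfFin rfl) := by simpa using hy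
        obtain ⟨k, rfl⟩ := this
        exact ⟨k, rfl⟩
    rw [himg] at hI
    ext x
    have hx : x ∈ J ↔ Equiv.swap i j x ∈ I := by
      rw [hI]; simp
    rw [hx]
    by_cases h1 : x = i
    · subst h1; simp [hi, hj]
    by_cases h2 : x = j
    · subst h2; simp [hi, hj]
    rw [Equiv.swap_apply_of_ne_of_ne h1 h2]

theorem map_topForm_monomial {f : (Fin n → K) →ₗ[K] (Fin n → K)} {a : Fin n → K}
    {π : Equiv.Perm (Fin n)} (hf : ∀ i, f (Pi.single i 1) = a i • Pi.single (π i) 1) :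
    ExteriorAlgebra.map f (topForm K n)
      = ((∏ i, a i) * ((Equiv.Perm.sign π : ℤ) : K)) • topForm K n := by
  rw [topForm, ExteriorAlgebra.map_apply_ιMulti]
  have : (f ∘ fun j => Pi.single j (1 : K))
      = fun j => a j • ((fun j => Pi.single j (1 : K)) ∘ π) j := by
    ext1 j; exact hf _
  rw [this, AlternatingMap.map_smul_univ, AlternatingMap.map_perm, Units.smul_def, mul_smul,
    Int.cast_smul_eq_zsmul]

/-- A repeated factor in an alternating product. -/
theorem ι_single_mul_topForm (j : Fin n) :
    ExteriorAlgebra.ι K (Pi.single j 1) * topForm K n = 0 := by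
  have h := AlternatingMap.map_eq_zero_of_eq (ExteriorAlgebra.ιMulti K (n + 1))
    (Matrix.vecCons (Pi.single j (1 : K)) fun i => Pi.single i (1 : K))
    (i := 0) (j := j.succ) (by simp) (Fin.succ_ne_zero j).symm
  rw [ExteriorAlgebra.ιMulti_succ_apply] at h
  simpa [topForm] using h

theorem exteriorPower_le_span_topForm :
    (⋀[K]^n (Fin n → K)) ≤ Submodule.span K {topForm K n} := by
  have hs : Submodule.span K (Set.range (Pi.basisFun K (Fin n))) = ⊤ :=
    (Pi.basisFun K (Fin n)).span_eq
  rw [← exteriorPower.ιMulti_family_span_fixedDegree_of_span K hs]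
  rw [Submodule.span_le]
  rintro _ ⟨s, rfl⟩
  rw [← ExteriorAlgebra.basis_apply_powersetCard]
  have : (s : Finset (Fin n)) = Finset.univ := by
    rw [← Finset.card_eq_iff_eq_univ, Fintype.card_fin]; exact s.2
  rw [this]
  exact Submodule.mem_span_singleton.2 ⟨1, by rw [one_smul, ← extBasis_univ]; rfl⟩

theorem topForm_mem_exteriorPower : topForm K n ∈ ⋀[K]^n (Fin n → K) :=
  ExteriorAlgebra.ιMulti_range K n ⟨_, rfl⟩

/-- The augmentation kills positive exterior powers and is the identity on scalars. -/
theorem eq_zero_of_algebraMap_mem_exteriorPower {k : ℕ} (hk : 0 < k) {c : K}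
    (h : algebraMap K (ExteriorAlgebra K (Fin n → K)) c ∈ ⋀[K]^k (Fin n → K)) : c = 0 := by
  have key : ∀ x ∈ ⋀[K]^k (Fin n → K),
      (ExteriorAlgebra.algebraMapInv : ExteriorAlgebra K (Fin n → K) →ₐ[K] K) x = 0 := by
    intro x hx
    rw [← ExteriorAlgebra.ιMulti_span_fixedDegree] at hx
    induction hx using Submodule.span_induction with
    | mem x hx =>
      obtain ⟨v, rfl⟩ := hx
      obtain ⟨k, rfl⟩ := Nat.exists_eq_succ_of_ne_zero hk.ne'
      rw [ExteriorAlgebra.ιMulti_succ_apply, map_mul]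
      simp [ExteriorAlgebra.algebraMapInv]
    | zero => simp
    | add x y _ _ hx hy => rw [map_add, hx, hy, add_zero]
    | smul a x _ hx => rw [map_smul, hx, smul_zero]
  have := key _ h
  rwa [ExteriorAlgebra.algebraMap_leftInverse (Fin n → K) c] at this

/-- The coefficient of `x^α` in a polynomial differential form. -/
def formCoeff (α : Fin n →₀ ℕ) : Forms K n →ₗ[K] ExteriorAlgebra K (Fin n → K) :=
  (TensorProduct.lid K _).toLinearMap ∘ₗ LinearMap.rTensor _ (MvPolynomial.lcoeff K α)

@[simp]
theorem formCoeff_tmul (α : Fin n →₀ ℕ) (h : MvPolynomial (Fin n) K)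
    (ξ : ExteriorAlgebra K (Fin n → K)) :
    formCoeff α (h ⊗ₜ[K] ξ) = h.coeff α • ξ := by
  simp [formCoeff]

theorem formsBasis_apply (α : Fin n →₀ ℕ) (I : Finset (Fin n)) :
    formsBasis K n (α, I) = MvPolynomial.monomial α 1 ⊗ₜ[K] extBasis K n I := by
  simp [formsBasis, extBasis, Module.Basis.tensorProduct_apply]

theorem formsBasis_repr (ω : Forms K n) (α : Fin n →₀ ℕ) (I : Finset (Fin n)) :
    (formsBasis K n).repr ω (α, I) = (extBasis K n).repr (formCoeff α ω) I := by
  induction ω using TensorProduct.induction_on with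
  | zero => simp
  | add x y hx hy => simp only [map_add, Finsupp.add_apply, hx, hy]
  | tmul h ξ =>
    rw [formsBasis, Module.Basis.tensorProduct_repr_tmul_apply, formCoeff_tmul, map_smul,
      Finsupp.smul_apply, smul_eq_mul, smul_eq_mul, mul_comm]
    rfl

theorem formCoeff_ext {ω η : Forms K n} (h : ∀ α, formCoeff α ω = formCoeff α η) : ω = η := by
  apply (formsBasis K n).repr.injective
  ext ⟨α, I⟩
  rw [formsBasis_repr, formsBasis_repr, h]

theorem formCoeff_mul (α : Fin n →₀ ℕ) (ω η : Forms K n) :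
    formCoeff α (ω * η)
      = ∑ x ∈ Finset.HasAntidiagonal.antidiagonal α, formCoeff x.1 ω * formCoeff x.2 η := by
  induction ω using TensorProduct.induction_on with
  | zero => simp
  | add x y hx hy => simp only [add_mul, map_add, hx, hy, Finset.sum_add_distrib]
  | tmul h ξ =>
    induction η using TensorProduct.induction_on with
    | zero => simp
    | add x y hx hy => simp only [mul_add, map_add, hx, hy, Finset.sum_add_distrib]
    | tmul g ζ =>
      simp only [Algebra.TensorProduct.tmul_mul_tmul, formCoeff_tmul, MvPolynomial.coeff_mul,
        Finset.sum_smul, smul_mul_smul_comm]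

/-! ### Monomial matrices in `G(m, p, n)` and their action -/

theorem inv_val_eq_monomialMatrix {σ : GL (Fin n) K} {π : Equiv.Perm (Fin n)} {a : Fin n → K}
    (ha : ∀ i, a i ≠ 0) (hσ : (σ : Matrix (Fin n) (Fin n) K) = monomialMatrix π a) :
    ((σ⁻¹ : GL (Fin n) K) : Matrix (Fin n) (Fin n) K)
      = monomialMatrix π⁻¹ fun j => (a (π⁻¹ j))⁻¹ := by
  have h1 : (σ : Matrix (Fin n) (Fin n) K)
      * monomialMatrix π⁻¹ (fun j => (a (π⁻¹ j))⁻¹) = 1 := by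
    rw [hσ, monomialMatrix_mul, mul_inv_cancel, ← monomialMatrix_one]
    congr 1
    funext j
    exact mul_inv_cancel₀ (ha _)
  have h2 : ((σ⁻¹ : GL (Fin n) K) : Matrix (Fin n) (Fin n) K)
      * (σ : Matrix (Fin n) (Fin n) K) = 1 := by
    rw [← Units.val_mul, inv_mul_cancel, Units.val_one]
  exact left_inv_eq_right_inv h2 h1

theorem polyAct_X {σ : GL (Fin n) K} {π : Equiv.Perm (Fin n)} {a : Fin n → K}
    (ha : ∀ i, a i ≠ 0) (hσ : (σ : Matrix (Fin n) (Fin n) K) = monomialMatrix π a) (j : Fin n) :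
    polyAct σ (MvPolynomial.X j) = MvPolynomial.C (a j)⁻¹ * MvPolynomial.X (π j) := by
  rw [polyAct, MvPolynomial.aeval_X, inv_val_eq_monomialMatrix ha hσ, Finset.sum_eq_single (π j)]
  · simp [monomialMatrix]
  · intro i _ hi
    have : j ≠ π⁻¹ i := by rintro rfl; simp at hi
    simp only [monomialMatrix, Matrix.of_apply, if_neg this, map_zero, zero_mul]
  · simp

theorem dualAct_single {σ : GL (Fin n) K} {π : Equiv.Perm (Fin n)} {a : Fin n → K}
    (ha : ∀ i, a i ≠ 0) (hσ : (σ : Matrix (Fin n) (Fin n) K) = monomialMatrix π a) (j : Fin n) :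
    dualAct σ (Pi.single j 1) = (a j)⁻¹ • Pi.single (π j) 1 := by
  ext i
  rw [dualAct, Matrix.vecMulLinear_apply, Matrix.single_one_vecMul,
    inv_val_eq_monomialMatrix ha hσ]
  by_cases h : i = π j
  · subst h; simp [monomialMatrix]
  · have : j ≠ π⁻¹ i := by rintro rfl; simp at h
    simp only [Matrix.row_apply, monomialMatrix, Matrix.of_apply, if_neg this, Pi.smul_apply, Pi.single_eq_of_ne h, smul_zero]

theorem ne_zero_of_pow_eq_one {m : ℕ} (hm : 0 < m) {a : Fin n → K} (ha : ∀ i, a i ^ m = 1)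
    (i : Fin n) : a i ≠ 0 := by
  intro h0
  have := ha i
  rw [h0, zero_pow hm.ne'] at this
  exact zero_ne_one this

theorem exists_mem_Gmpn {m p : ℕ} (hm : 0 < m) (π : Equiv.Perm (Fin n)) {a : Fin n → K}
    (ha : ∀ i, a i ^ m = 1) (ha' : (∏ i, a i) ^ (m / p) = 1) :
    ∃ σ ∈ Gmpn K m p n, (σ : Matrix (Fin n) (Fin n) K) = monomialMatrix π a := by
  have hne := ne_zero_of_pow_eq_one hm ha
  have h1 : monomialMatrix π a * monomialMatrix π⁻¹ (fun j => (a (π⁻¹ j))⁻¹) = 1 := by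
    rw [monomialMatrix_mul, mul_inv_cancel, ← monomialMatrix_one]
    congr 1
    funext j
    exact mul_inv_cancel₀ (hne _)
  have h2 : monomialMatrix π⁻¹ (fun j => (a (π⁻¹ j))⁻¹) * monomialMatrix π a = 1 := by
    rw [monomialMatrix_mul, inv_mul_cancel, ← monomialMatrix_one]
    congr 1
    funext j
    rw [show π⁻¹ (π j) = j from Equiv.symm_apply_apply π j]
    exact inv_mul_cancel₀ (hne _)
  exact ⟨⟨_, _, h1, h2⟩, ⟨π, a, ha, ha', rfl⟩, rfl⟩

theorem det_monomialMatrix (π : Equiv.Perm (Fin n)) (a : Fin n → K) :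
    (monomialMatrix π a).det = (∏ i, a i) * ((Equiv.Perm.sign π : ℤ) : K) := by
  have : monomialMatrix π a = (Matrix.diagonal a).submatrix (π⁻¹ : Equiv.Perm (Fin n)) id := by
    ext i j
    by_cases h : i = π j
    · subst h; simp [monomialMatrix]
    · have : π⁻¹ i ≠ j := by rintro rfl; simp at h
      simp only [monomialMatrix, Matrix.of_apply, if_neg h, Matrix.submatrix_apply, id_eq,
        Matrix.diagonal_apply_ne _ this]
  rw [this, Matrix.det_permute, Matrix.det_diagonal, mul_comm, Equiv.Perm.sign_inv]

theorem polyAct_monomial {σ : GL (Fin n) K} {π : Equiv.Perm (Fin n)} {a : Fin n → K}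
    (ha : ∀ i, a i ≠ 0) (hσ : (σ : Matrix (Fin n) (Fin n) K) = monomialMatrix π a)
    (α : Fin n →₀ ℕ) (c : K) :
    polyAct σ (MvPolynomial.monomial α c)
      = MvPolynomial.monomial (α.mapDomain π) ((∏ i, (a i)⁻¹ ^ α i) * c) := by
  rw [MvPolynomial.monomial_eq, map_mul, ← MvPolynomial.algebraMap_eq, AlgHom.commutes,
    Finsupp.prod_fintype _ _ (by simp), map_prod]
  simp_rw [map_pow, polyAct_X ha hσ, mul_pow]
  rw [Finset.prod_mul_distrib, MvPolynomial.monomial_eq,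
    Finsupp.prod_mapDomain_index_inj π.injective, Finsupp.prod_fintype _ _ (by simp)]
  simp only [MvPolynomial.algebraMap_eq, map_mul, map_prod, map_pow]
  ring

theorem coeff_polyAct {σ : GL (Fin n) K} {π : Equiv.Perm (Fin n)} {a : Fin n → K}
    (ha : ∀ i, a i ≠ 0) (hσ : (σ : Matrix (Fin n) (Fin n) K) = monomialMatrix π a)
    (α : Fin n →₀ ℕ) (h : MvPolynomial (Fin n) K) :
    (polyAct σ h).coeff (α.mapDomain π) = (∏ i, (a i)⁻¹ ^ α i) * h.coeff α := by
  induction h using MvPolynomial.induction_on' with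
  | monomial β c =>
    rw [polyAct_monomial ha hσ, MvPolynomial.coeff_monomial, MvPolynomial.coeff_monomial]
    by_cases hβ : β = α
    · simp [hβ]
    · rw [if_neg (fun h => hβ (Finsupp.mapDomain_injective π.injective h)), if_neg hβ, mul_zero]
  | add f g hf hg => simp only [map_add, MvPolynomial.coeff_add, hf, hg, mul_add]

theorem formCoeff_formAct {σ : GL (Fin n) K} {π : Equiv.Perm (Fin n)} {a : Fin n → K}
    (ha : ∀ i, a i ≠ 0) (hσ : (σ : Matrix (Fin n) (Fin n) K) = monomialMatrix π a)
    (α : Fin n →₀ ℕ) (ω : Forms K n) :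
    formCoeff (α.mapDomain π) (formAct σ ω)
      = (∏ i, (a i)⁻¹ ^ α i) • ExteriorAlgebra.map (dualAct σ) (formCoeff α ω) := by
  induction ω using TensorProduct.induction_on with
  | zero => simp
  | add x y hx hy => simp only [map_add, hx, hy, smul_add]
  | tmul h ξ =>
    rw [formAct, Algebra.TensorProduct.map_tmul, formCoeff_tmul, formCoeff_tmul,
      coeff_polyAct ha hσ, map_smul, smul_smul]

theorem formAct_tmul_topForm {σ : GL (Fin n) K} {π : Equiv.Perm (Fin n)} {a : Fin n → K}
    (ha : ∀ i, a i ≠ 0) (hσ : (σ : Matrix (Fin n) (Fin n) K) = monomialMatrix π a)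
    (h : MvPolynomial (Fin n) K) :
    formAct σ (h ⊗ₜ[K] topForm K n)
      = ((∏ i, (a i)⁻¹) * ((Equiv.Perm.sign π : ℤ) : K)) • polyAct σ h ⊗ₜ[K] topForm K n := by
  rw [formAct, Algebra.TensorProduct.map_tmul, map_topForm_monomial (dualAct_single ha hσ),
    TensorProduct.tmul_smul, TensorProduct.smul_tmul']

/-! ### Differential operators -/

/-- The operator `∂_{x_i}` on polynomials. -/
abbrev polyD (i : Fin n) : Module.End K (MvPolynomial (Fin n) K) :=
  (MvPolynomial.pderiv i : Derivation K (MvPolynomial (Fin n) K) (MvPolynomial (Fin n) K))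

theorem dX_tmul (i : Fin n) (h : MvPolynomial (Fin n) K) (ξ : ExteriorAlgebra K (Fin n → K)) :
    dX i (h ⊗ₜ[K] ξ) = MvPolynomial.pderiv i h ⊗ₜ[K] ξ := rfl

theorem dX_pow_tmul (i : Fin n) (k : ℕ) (h : MvPolynomial (Fin n) K)
    (ξ : ExteriorAlgebra K (Fin n → K)) :
    (dX i ^ k) (h ⊗ₜ[K] ξ)
      = (polyD i ^ k) h ⊗ₜ[K] ξ := by
  induction k with
  | zero => rfl
  | succ k ih => rw [pow_succ', Module.End.mul_apply, ih, pow_succ', Module.End.mul_apply]; rfl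

theorem list_dX_prod_tmul (l : List (Fin n)) (α : Fin n → ℕ) (h : MvPolynomial (Fin n) K)
    (ξ : ExteriorAlgebra K (Fin n → K)) :
    (l.map fun i => (dX i : Module.End K (Forms K n)) ^ α i).prod (h ⊗ₜ[K] ξ)
      = (l.map fun i => polyD i ^ α i).prod h ⊗ₜ[K] ξ := by
  induction l with
  | nil => rfl
  | cons i l ih =>
    rw [List.map_cons, List.prod_cons, Module.End.mul_apply, ih, dX_pow_tmul, List.map_cons,
      List.prod_cons, Module.End.mul_apply]

theorem list_dTheta_prod_tmul (l : List (Fin n)) :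
    ∃ f : Module.End K (ExteriorAlgebra K (Fin n → K)),
      (l.map (dTheta : Fin n → Module.End K (Forms K n))).prod = LinearMap.lTensor _ f := by
  induction l with
  | nil => exact ⟨1, by simp [Module.End.one_eq_id]⟩
  | cons i l ih =>
    obtain ⟨f, hf⟩ := ih
    exact ⟨_ * f, by rw [List.map_cons, List.prod_cons, hf, LinearMap.lTensor_mul]; rfl⟩

/-- The two tensor factors are acted on separately, so vanishing can be decided on the polynomial
factor alone. -/
theorem formDiffMonomial_tmul (α : Fin n →₀ ℕ) (I : Finset (Fin n)) :
    ∃ f : Module.End K (ExteriorAlgebra K (Fin n → K)), ∀ h ξ,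
      formDiffMonomial α I (h ⊗ₜ[K] ξ) = polyDiffMonomial α h ⊗ₜ[K] f ξ := by
  obtain ⟨f, hf⟩ := list_dTheta_prod_tmul (K := K) (I.sort (· ≤ ·)).reverse
  refine ⟨f, fun h ξ => ?_⟩
  rw [formDiffMonomial, Module.End.mul_apply, hf, LinearMap.lTensor_tmul, List.ofFn_eq_map,
    list_dX_prod_tmul, polyDiffMonomial, List.ofFn_eq_map]

/-! ### Coefficients of derivatives -/

/-- The multifactorial `α! = α_1! ⋯ α_n!` in `K`. -/
def multifactorial (K : Subfield ℂ) {n : ℕ} (α : Fin n →₀ ℕ) : K := ∏ i, ((α i).factorial : K)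

theorem multifactorial_ne_zero (α : Fin n →₀ ℕ) : multifactorial K α ≠ 0 :=
  Finset.prod_ne_zero_iff.2 fun _ _ => Nat.cast_ne_zero.2 (Nat.factorial_ne_zero _)

theorem multifactorial_add_single (α : Fin n →₀ ℕ) (i : Fin n) :
    multifactorial K (α + Finsupp.single i 1) = multifactorial K α * (α i + 1) := by
  unfold multifactorial
  rw [← Finset.mul_prod_erase _ _ (Finset.mem_univ i),
    ← Finset.mul_prod_erase Finset.univ (fun i => ((α i).factorial : K)) (Finset.mem_univ i)]
  have : ∀ j ∈ Finset.univ.erase i, (((α + Finsupp.single i 1 : Fin n →₀ ℕ) j).factorial : K)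
      = ((α j).factorial : K) := fun j hj => by
    rw [Finsupp.add_apply, Finsupp.single_eq_of_ne (Finset.ne_of_mem_erase hj), add_zero]
  rw [Finset.prod_congr rfl this, Finsupp.add_apply, Finsupp.single_eq_same,
    Nat.factorial_succ]
  push_cast
  ring

/-- Once the coefficient at `γ` is weighted by `γ!`, differentiation is a pure shift of exponents,
with no numerical factors. -/
theorem multifactorial_mul_coeff_pderiv_pow (i : Fin n) (k : ℕ) (γ : Fin n →₀ ℕ)
    (f : MvPolynomial (Fin n) K) :
    multifactorial K γ * ((polyD i ^ k) f).coeff γ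
      = multifactorial K (γ + Finsupp.single i k) * f.coeff (γ + Finsupp.single i k) := by
  induction k generalizing γ with
  | zero => simp
  | succ k ih =>
    rw [pow_succ', Module.End.mul_apply, Derivation.coeFn_coe, MvPolynomial.coeff_pderiv,
      add_comm k 1, Finsupp.single_add, ← add_assoc, ← ih, multifactorial_add_single]
    ring

theorem multifactorial_mul_coeff_polyDiffMonomial (α γ : Fin n →₀ ℕ)
    (f : MvPolynomial (Fin n) K) :
    multifactorial K γ * (polyDiffMonomial α f).coeff γ
      = multifactorial K (γ + α) * f.coeff (γ + α) := by
  have key : ∀ (l : List (Fin n)) (γ : Fin n →₀ ℕ),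
      multifactorial K γ * ((l.map fun i => polyD i ^ α i).prod f).coeff γ
      = multifactorial K (γ + (l.map fun i => Finsupp.single i (α i)).sum)
        * f.coeff (γ + (l.map fun i => Finsupp.single i (α i)).sum) := by
    intro l
    induction l with
    | nil => intro γ; simp
    | cons i l ih =>
      intro γ
      rw [List.map_cons, List.prod_cons, Module.End.mul_apply,
        multifactorial_mul_coeff_pderiv_pow, ih, List.map_cons, List.sum_cons, add_assoc]
  have hα : ((List.finRange n).map fun i => Finsupp.single i (α i)).sum = α := by
    rw [← List.ofFn_eq_map, List.sum_ofFn, Finsupp.univ_sum_single]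
  rw [polyDiffMonomial, List.ofFn_eq_map, key, hα]

/-- Together with the next lemma: a monomial operator `∂^α` kills `f` exactly when no exponent of
`f` dominates `α`. -/
theorem polyDiffMonomial_eq_zero {α : Fin n →₀ ℕ} {f : MvPolynomial (Fin n) K}
    (h : ∀ β, α ≤ β → f.coeff β = 0) : polyDiffMonomial α f = 0 := by
  ext γ
  have := multifactorial_mul_coeff_polyDiffMonomial α γ f
  rw [h _ le_add_self, mul_zero] at this
  simpa using (mul_eq_zero.1 this).resolve_left (multifactorial_ne_zero γ)

theorem coeff_eq_zero_of_polyDiffMonomial_eq_zero {α β : Fin n →₀ ℕ}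
    {f : MvPolynomial (Fin n) K} (h : polyDiffMonomial α f = 0) (hαβ : α ≤ β) :
    f.coeff β = 0 := by
  have := multifactorial_mul_coeff_polyDiffMonomial α (β - α) f
  rw [h, MvPolynomial.coeff_zero, mul_zero, tsub_add_cancel_of_le hαβ] at this
  exact (mul_eq_zero.1 this.symm).resolve_left (multifactorial_ne_zero β)

theorem pderiv_comm (i j : Fin n) (h : MvPolynomial (Fin n) K) :
    MvPolynomial.pderiv i (MvPolynomial.pderiv j h)
      = MvPolynomial.pderiv j (MvPolynomial.pderiv i h) := by
  by_cases hij : i = j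
  · rw [hij]
  ext γ
  rw [MvPolynomial.coeff_pderiv, MvPolynomial.coeff_pderiv, MvPolynomial.coeff_pderiv,
    MvPolynomial.coeff_pderiv, add_right_comm, Finsupp.add_apply, Finsupp.add_apply,
    Finsupp.single_eq_of_ne hij, Finsupp.single_eq_of_ne (Ne.symm hij), add_zero, add_zero,
    mul_right_comm]

theorem dX_comm (i j : Fin n) : Commute (dX i : Module.End K (Forms K n)) (dX j) :=
  TensorProduct.ext' fun h ξ => congrArg (fun g => g ⊗ₜ[K] ξ) (pderiv_comm i j h)

theorem dX_comm_dTheta (i j : Fin n) :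
    Commute (dX i : Module.End K (Forms K n)) (dTheta j) :=
  TensorProduct.ext' fun _ _ => rfl

/-- Contraction is an antiderivation; apply it to `θ_j θ_1 ⋯ θ_n = 0`. -/
theorem theta_mul_contract_topForm (i j : Fin n) :
    ExteriorAlgebra.ι K (Pi.single j 1) *
      CliffordAlgebra.contractLeft (Q := (0 : QuadraticForm K (Fin n → K)))
        (LinearMap.proj i : (Fin n → K) →ₗ[K] K) (topForm K n)
      = (if i = j then (1 : K) else 0) • topForm K n := by
  have h := CliffordAlgebra.contractLeft_ι_mul (Q := (0 : QuadraticForm K (Fin n → K)))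
    (d := (LinearMap.proj i : (Fin n → K) →ₗ[K] K)) (Pi.single j 1) (topForm K n)
  have h0 : CliffordAlgebra.ι (0 : QuadraticForm K (Fin n → K)) (Pi.single j 1) * topForm K n = 0 :=
    ι_single_mul_topForm j
  rw [h0, map_zero] at h
  have h1 := (sub_eq_zero.1 h.symm).symm
  refine h1.trans ?_
  simp [Pi.single_apply]

/-! ### The operators `∂_g` and `∂_ω`. -/

section Conj
variable [ConjClosed K]

theorem polyDiff_eq_sum {g : MvPolynomial (Fin n) K} {S : Finset (Fin n →₀ ℕ)}
    (hS : g.support ⊆ S) :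
    polyDiff g = ∑ α ∈ S, conjK K (g.coeff α) • polyDiffMonomial α := by
  refine Finset.sum_subset hS fun α _ hα => ?_
  rw [MvPolynomial.notMem_support_iff.1 hα, map_zero, zero_smul]

theorem polyDiff_add (f g : MvPolynomial (Fin n) K) :
    polyDiff (f + g) = polyDiff f + polyDiff g := by
  classical
  rw [polyDiff_eq_sum MvPolynomial.support_add, polyDiff_eq_sum Finset.subset_union_left,
    polyDiff_eq_sum Finset.subset_union_right, ← Finset.sum_add_distrib]
  refine Finset.sum_congr rfl fun α _ => ?_
  rw [MvPolynomial.coeff_add, map_add, add_smul]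

theorem polyDiff_sum {ι : Type*} (s : Finset ι) (f : ι → MvPolynomial (Fin n) K) :
    polyDiff (∑ i ∈ s, f i) = ∑ i ∈ s, polyDiff (f i) := by
  classical
  induction s using Finset.induction_on with
  | empty => rw [Finset.sum_empty, Finset.sum_empty, polyDiff_eq_sum (S := ∅) (by simp)]; simp
  | insert a s ha ih => rw [Finset.sum_insert ha, Finset.sum_insert ha, polyDiff_add, ih]

theorem polyDiff_monomial_one (α : Fin n →₀ ℕ) :
    polyDiff (MvPolynomial.monomial α (1 : K)) = polyDiffMonomial α := by
  simp [polyDiff, MvPolynomial.support_monomial]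

theorem polyDiff_eq_zero {g f : MvPolynomial (Fin n) K}
    (h : ∀ α, g.coeff α ≠ 0 → polyDiffMonomial α f = 0) : polyDiff g f = 0 := by
  rw [polyDiff, LinearMap.sum_apply]
  refine Finset.sum_eq_zero fun α hα => ?_
  rw [LinearMap.smul_apply, h α (MvPolynomial.mem_support_iff.1 hα), smul_zero]

theorem formDiff_add (ω η : Forms K n) : formDiff (ω + η) = formDiff ω + formDiff η := by
  rw [formDiff, map_add]
  exact Finsupp.sum_add_index' (by simp) (by simp [add_smul])

theorem formDiff_sum {ι : Type*} (s : Finset ι) (f : ι → Forms K n) :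
    formDiff (∑ i ∈ s, f i) = ∑ i ∈ s, formDiff (f i) := by
  classical
  induction s using Finset.induction_on with
  | empty => rw [Finset.sum_empty, Finset.sum_empty, formDiff, map_zero, Finsupp.sum_zero_index]
  | insert a s ha ih => rw [Finset.sum_insert ha, Finset.sum_insert ha, formDiff_add, ih]

theorem formDiff_formsBasis (α : Fin n →₀ ℕ) (I : Finset (Fin n)) :
    formDiff (formsBasis K n (α, I)) = formDiffMonomial α I := by
  rw [formDiff, Module.Basis.repr_self, Finsupp.sum_single_index] <;> simp

theorem formDiff_tmul_eq_zero {ω : Forms K n} {h : MvPolynomial (Fin n) K}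
    {ξ : ExteriorAlgebra K (Fin n → K)}
    (H : ∀ α, formCoeff α ω ≠ 0 → polyDiffMonomial α h = 0) : formDiff ω (h ⊗ₜ[K] ξ) = 0 := by
  rw [formDiff, Finsupp.sum, LinearMap.sum_apply]
  refine Finset.sum_eq_zero fun αI hα => ?_
  obtain ⟨f, hf⟩ := formDiffMonomial_tmul (K := K) αI.1 αI.2
  rw [LinearMap.smul_apply, hf, H αI.1, TensorProduct.zero_tmul, smul_zero]
  intro h0
  rw [Finsupp.mem_support_iff] at hα
  apply hα
  have := formsBasis_repr ω αI.1 αI.2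
  rwa [h0, map_zero] at this

theorem dX_comm_formDiff (i : Fin n) (ω : Forms K n) :
    Commute (dX i : Module.End K (Forms K n)) (formDiff ω) := by
  rw [formDiff, Finsupp.sum]
  refine Commute.sum_right _ _ _ fun αI _ => Commute.smul_right (Commute.mul_right ?_ ?_) _
  · refine Commute.list_prod_right _ _ fun P hP => ?_
    rw [List.mem_ofFn] at hP
    obtain ⟨j, rfl⟩ := hP
    exact (dX_comm i j).pow_right _
  · refine Commute.list_prod_right _ _ fun P hP => ?_
    rw [List.mem_map] at hP
    obtain ⟨j, _, rfl⟩ := hP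
    exact dX_comm_dTheta i j

/-- The operator yields `∑ ∂^(γ i) h ⊗ ∂_{θ_i}(θ_1 ⋯ θ_n)`. Left multiplication by `θ_j` isolates
the `j`th summand, so one equation splits into `n`. -/
theorem polyDiffMonomial_eq_zero_of_formDiff (γ : Fin n → Fin n →₀ ℕ)
    {h : MvPolynomial (Fin n) K}
    (H : formDiff (∑ i, formsBasis K n (γ i, {i})) (h ⊗ₜ[K] topForm K n) = 0) (j : Fin n) :
    polyDiffMonomial (γ j) h = 0 := by
  rw [formDiff_sum, LinearMap.sum_apply] at H
  have hsingle : ∀ i, formDiff (formsBasis K n (γ i, {i})) (h ⊗ₜ[K] topForm K n)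
      = polyDiffMonomial (γ i) h ⊗ₜ[K]
        CliffordAlgebra.contractLeft (Q := (0 : QuadraticForm K (Fin n → K)))
        (LinearMap.proj i : (Fin n → K) →ₗ[K] K) (topForm K n) := by
    intro i
    rw [formDiff_formsBasis, formDiffMonomial, Module.End.mul_apply, List.ofFn_eq_map,
      polyDiffMonomial, List.ofFn_eq_map, ← list_dX_prod_tmul]
    simp [dTheta]
  simp_rw [hsingle] at H
  have H2 := congrArg (fun x => (theta j : Forms K n) * x) H
  simp only [Finset.mul_sum, theta, Algebra.TensorProduct.tmul_mul_tmul, mul_zero, one_mul,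
    theta_mul_contract_topForm] at H2
  rw [Finset.sum_eq_single j (fun i _ hij => by rw [if_neg hij, zero_smul, TensorProduct.tmul_zero])
    (by simp), if_pos rfl, one_smul] at H2
  ext δ
  have H3 := congrArg (formCoeff δ) H2
  rw [formCoeff_tmul, map_zero] at H3
  simpa using (smul_eq_zero.1 H3).resolve_right topForm_ne_zero

end Conj

/-- The forms all of whose `x`-exponents lie in an upper set. -/
def exponentIdeal (K : Subfield ℂ) {n : ℕ} (U : Set (Fin n →₀ ℕ)) (hU : IsUpperSet U) :
    TwoSidedIdeal (Forms K n) :=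
  TwoSidedIdeal.mk' {ω | ∀ α, α ∉ U → formCoeff α ω = 0}
    (fun _ _ => map_zero _)
    (fun hx hy α hα => by rw [map_add, hx α hα, hy α hα, add_zero])
    (fun hx α hα => by rw [map_neg, hx α hα, neg_zero])
    (fun {x y} hy α hα => by
      rw [formCoeff_mul]
      refine Finset.sum_eq_zero fun z hz => ?_
      rw [hy z.2, mul_zero]
      intro h
      refine hα (hU ?_ h)
      rw [← Finset.HasAntidiagonal.mem_antidiagonal.1 hz]
      exact le_add_self)
    (fun {x y} hx α hα => by
      rw [formCoeff_mul]
      refine Finset.sum_eq_zero fun z hz => ?_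
      rw [hx z.1, zero_mul]
      intro h
      refine hα (hU ?_ h)
      rw [← Finset.HasAntidiagonal.mem_antidiagonal.1 hz]
      exact le_self_add)

theorem mem_exponentIdeal {U : Set (Fin n →₀ ℕ)} {hU : IsUpperSet U} {ω : Forms K n} :
    ω ∈ exponentIdeal K U hU ↔ ∀ α, α ∉ U → formCoeff α ω = 0 := by
  rw [exponentIdeal, TwoSidedIdeal.mem_mk']; rfl

/-- The polynomials all of whose exponents lie in an upper set. -/
def exponentIdealPoly (K : Subfield ℂ) {n : ℕ} (U : Set (Fin n →₀ ℕ)) (hU : IsUpperSet U) :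
    Ideal (MvPolynomial (Fin n) K) where
  carrier := {g | ∀ α, α ∉ U → g.coeff α = 0}
  zero_mem' := fun _ _ => MvPolynomial.coeff_zero _
  add_mem' := fun hx hy α hα => by rw [MvPolynomial.coeff_add, hx α hα, hy α hα, add_zero]
  smul_mem' := fun x y hy α hα => by
    rw [smul_eq_mul, MvPolynomial.coeff_mul]
    refine Finset.sum_eq_zero fun z hz => ?_
    rw [hy z.2, mul_zero]
    intro h
    refine hα (hU ?_ h)
    rw [← Finset.HasAntidiagonal.mem_antidiagonal.1 hz]
    exact le_add_self

/-! ### Degrees -/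

theorem formCoeff_mem_of_mem_bidegree {i k : ℕ} {ω : Forms K n} (h : ω ∈ bidegree K n i k)
    (α : Fin n →₀ ℕ) : formCoeff α ω ∈ ⋀[K]^k (Fin n → K) ∧
      (α.degree ≠ i → formCoeff α ω = 0) := by
  obtain ⟨x, rfl⟩ := h
  induction x using TensorProduct.induction_on with
  | zero => simp
  | add x y hx hy =>
    simp only [map_add]
    exact ⟨add_mem hx.1 hy.1, fun h => by rw [hx.2 h, hy.2 h, add_zero]⟩
  | tmul h ξ =>
    rw [TensorProduct.mapIncl, TensorProduct.map_tmul, formCoeff_tmul]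
    refine ⟨Submodule.smul_mem _ _ ξ.2, fun hd => ?_⟩
    have : (h : MvPolynomial (Fin n) K).coeff α = 0 :=
      MvPolynomial.IsHomogeneous.coeff_eq_zero h.2 hd
    rw [Submodule.subtype_apply, this, zero_smul]

theorem tmul_mem_bidegree {i k : ℕ} {h : MvPolynomial (Fin n) K}
    {ξ : ExteriorAlgebra K (Fin n → K)} (hh : h.IsHomogeneous i) (hξ : ξ ∈ ⋀[K]^k (Fin n → K)) :
    h ⊗ₜ[K] ξ ∈ bidegree K n i k :=
  ⟨(⟨h, hh⟩ : MvPolynomial.homogeneousSubmodule (Fin n) K i) ⊗ₜ (⟨ξ, hξ⟩ : ⋀[K]^k (Fin n → K)), rfl⟩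

theorem bidegree_le_thetaDegree (i k : ℕ) : bidegree K n i k ≤ thetaDegree K n k := by
  rintro _ ⟨x, rfl⟩
  induction x using TensorProduct.induction_on with
  | zero => simp
  | add x y hx hy => rw [map_add]; exact add_mem hx hy
  | tmul h ξ => exact ⟨(h : MvPolynomial (Fin n) K) ⊗ₜ ξ, rfl⟩

theorem tmul_topForm_mem_thetaDegree (h : MvPolynomial (Fin n) K) :
    h ⊗ₜ[K] topForm K n ∈ thetaDegree K n n :=
  ⟨h ⊗ₜ[K] ⟨topForm K n, topForm_mem_exteriorPower⟩, rfl⟩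

theorem exists_eq_tmul_topForm {ω : Forms K n} (h : ω ∈ thetaDegree K n n) :
    ∃ g : MvPolynomial (Fin n) K, ω = g ⊗ₜ[K] topForm K n := by
  obtain ⟨x, rfl⟩ := h
  induction x using TensorProduct.induction_on with
  | zero => exact ⟨0, by simp⟩
  | add x y hx hy =>
    obtain ⟨f, hf⟩ := hx
    obtain ⟨g, hg⟩ := hy
    exact ⟨f + g, by rw [map_add, hf, hg, TensorProduct.add_tmul]⟩
  | tmul h ξ =>
    obtain ⟨c, hc⟩ := Submodule.mem_span_singleton.1 (exteriorPower_le_span_topForm ξ.2)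
    exact ⟨c • h, by
      rw [LinearMap.lTensor_tmul, Submodule.subtype_apply, ← hc, TensorProduct.smul_tmul]⟩

/-! ### Generic parameters and characters of the diagonal subgroup. -/

variable {m p q : ℕ}

/-- The parameters `(m, p, n)` with `m = p q` for which `G(m, p, n)` is not one of the
exceptional families. -/
structure IsGenericParams (m p q n : ℕ) : Prop where
  eq_mul : m = p * q
  q_pos : 0 < q
  two_le_p : 2 ≤ p
  three_le_m : 3 ≤ m
  two_le_n : 2 ≤ n
  three_le_n : q = 1 → 3 ≤ n

namespace IsGenericParams

theorem div_eq (h : IsGenericParams m p q n) : m / p = q := by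
  rw [h.eq_mul]; exact Nat.mul_div_cancel_left q (by have := h.two_le_p; omega)

theorem two_mul_q_le (h : IsGenericParams m p q n) : 2 * q ≤ m := by
  rw [h.eq_mul]; exact Nat.mul_le_mul_right q h.two_le_p

theorem m_pos (h : IsGenericParams m p q n) : 0 < m := by have := h.three_le_m; omega

end IsGenericParams

/-- The exponents of the monomials in the ideal generated by the partial derivatives of the basic
invariants of `G(m, p, n)`, for `q = m / p`. -/
def jacobianExponents (m q n : ℕ) : Set (Fin n →₀ ℕ) :=
  {α | (∃ i, m - 1 ≤ α i) ∨ ∃ j, ∀ i, (if i = j then q - 1 else q) ≤ α i}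

theorem isUpperSet_jacobianExponents (m q n : ℕ) : IsUpperSet (jacobianExponents m q n) := by
  rintro α β hαβ (⟨i, hi⟩ | ⟨j, hj⟩)
  · exact Or.inl ⟨i, hi.trans (hαβ i)⟩
  · exact Or.inr ⟨j, fun i => (hj i).trans (hαβ i)⟩

theorem exists_primitiveRoot_mem (hm : 0 < m) (hroots : ∀ z : ℂ, z ^ m = 1 → z ∈ K) :
    ∃ ζ : K, IsPrimitiveRoot ζ m := by
  have h := Complex.isPrimitiveRoot_exp m hm.ne'
  exact ⟨⟨_, hroots _ h.pow_eq_one⟩,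
    IsPrimitiveRoot.of_map_of_injective (f := K.subtype) h K.subtype.injective⟩

/-- A character of the diagonal subgroup of `G(m, p, n)` that is trivial has exponents that are
congruent to each other modulo `m` and divisible by `q = m / p`. -/
theorem exponents_of_trivial_character (hP : IsGenericParams m p q n) {ζ : K}
    (hζ : IsPrimitiveRoot ζ m) {δ : Fin n → ℤ}
    (H : ∀ a : Fin n → K, (∀ i, a i ^ m = 1) → (∏ i, a i) ^ (m / p) = 1 →
      ∏ i, a i ^ δ i = 1) :
    (∀ i j, (m : ℤ) ∣ δ i - δ j) ∧ ∀ i, (q : ℤ) ∣ δ i := by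
  have hζ0 : ζ ≠ 0 := hζ.ne_zero hP.m_pos.ne'
  constructor
  · intro i j
    by_cases hij : i = j
    · simp [hij]
    -- This diagonal matrix has determinant 1, so it lies in the group for every `p`.
    have h := H (fun k => if k = i then ζ else if k = j then ζ⁻¹ else 1)
      (fun k => by split_ifs <;> simp [hζ.pow_eq_one]) (by
        rw [← Finset.prod_subset (Finset.subset_univ {i, j}), Finset.prod_pair hij]
        · simp [Ne.symm hij, hζ0]
        · intro x _ hx
          simp only [Finset.mem_insert, Finset.mem_singleton, not_or] at hx
          simp [hx.1, hx.2])
    rw [← Finset.prod_subset (Finset.subset_univ {i, j}), Finset.prod_pair hij] at h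
    · simp only [if_true, if_neg (Ne.symm hij)] at h
      rw [inv_zpow, ← zpow_neg, ← zpow_add₀ hζ0, hζ.zpow_eq_one_iff_dvd] at h
      exact h
    · intro x _ hx
      simp only [Finset.mem_insert, Finset.mem_singleton, not_or] at hx
      simp [hx.1, hx.2]
  · intro i
    -- The root `ζ ^ p` has order `q`, so a single such entry is allowed.
    have h := H (fun k => if k = i then ζ ^ p else 1)
      (fun k => by
        split_ifs
        · rw [← pow_mul, mul_comm, pow_mul, hζ.pow_eq_one, one_pow]
        · simp) (by
        rw [Finset.prod_ite_eq' Finset.univ i, if_pos (Finset.mem_univ i), hP.div_eq, ← pow_mul,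
          ← hP.eq_mul, hζ.pow_eq_one])
    rw [Finset.prod_eq_single i (fun k _ hk => by simp [hk]) (by simp), if_pos rfl, ← zpow_natCast,
      ← zpow_mul, hζ.zpow_eq_one_iff_dvd, hP.eq_mul] at h
    push_cast at h
    exact Int.dvd_of_mul_dvd_mul_left (by have := hP.two_le_p; omega) h

theorem prod_inv_pow_eq_one_iff (a : Fin n → K) (α : Fin n → ℕ) :
    ∏ i, (a i)⁻¹ ^ α i = 1 ↔ ∏ i, a i ^ (α i : ℤ) = 1 := by
  simp only [inv_pow, Finset.prod_inv_distrib, inv_eq_one, zpow_natCast]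

theorem mapDomain_swap_eq {i j : Fin n} {α : Fin n →₀ ℕ} (hα : α i = α j) :
    α.mapDomain (Equiv.swap i j) = α := by
  ext k
  rw [Finsupp.mapDomain_equiv_apply, Equiv.symm_swap]
  by_cases h1 : k = i
  · rw [h1, Equiv.swap_apply_left, hα]
  by_cases h2 : k = j
  · rw [h2, Equiv.swap_apply_right, hα]
  rw [Equiv.swap_apply_of_ne_of_ne h1 h2]

theorem formCoeff_formAct_swap {σ : GL (Fin n) K} {i j : Fin n}
    (hσ : (σ : Matrix (Fin n) (Fin n) K) = monomialMatrix (Equiv.swap i j) fun _ => 1)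
    {α : Fin n →₀ ℕ} (hα : α i = α j) (ω : Forms K n) :
    formCoeff α (formAct σ ω) = ExteriorAlgebra.map (dualAct σ) (formCoeff α ω) := by
  have h := formCoeff_formAct (fun _ => one_ne_zero) hσ α ω
  rw [mapDomain_swap_eq hα] at h
  simpa using h

theorem exists_swap_mem (hm : 0 < m) (i j : Fin n) : ∃ σ ∈ Gmpn K m p n,
    (σ : Matrix (Fin n) (Fin n) K) = monomialMatrix (Equiv.swap i j) fun _ => 1 :=
  exists_mem_Gmpn hm _ (by simp) (by simp)

/-! ### Exponents of invariant forms. -/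

/-- Under diagonal matrices `x^α θ_I` transforms like a monomial with exponent `δ = α + 1_I`, so the
entries of `δ` are congruent modulo `m` and divisible by `q`. If some entry vanishes, all are
multiples of `m`, and a non-zero one gives `α_j ≥ m - 1`. Otherwise all are at least `q`, and the
size of `I` decides which generator of the upper set lies below `α`. -/
theorem formCoeff_repr_ne_zero (hP : IsGenericParams m p q n) {ζ : K} (hζ : IsPrimitiveRoot ζ m)
    {ω : Forms K n} (hω : ∀ σ ∈ Gmpn K m p n, formAct σ ω = ω) {α : Fin n →₀ ℕ}
    {I : Finset (Fin n)} (h : (extBasis K n).repr (formCoeff α ω) I ≠ 0) :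
    α ∈ jacobianExponents m q n ∨ (α = 0 ∧ I = ∅) := by
  set δ : Fin n → ℕ := fun i => α i + if i ∈ I then 1 else 0 with hδ
  have hchar := exponents_of_trivial_character (δ := fun i => (δ i : ℤ)) hP hζ (by
    intro a ha ha'
    obtain ⟨σ, hσ, hσa⟩ := exists_mem_Gmpn hP.m_pos 1 ha ha'
    have hne := ne_zero_of_pow_eq_one hP.m_pos ha
    have h1 := formCoeff_formAct hne hσa α ω
    rw [hω σ hσ, Equiv.Perm.coe_one, Finsupp.mapDomain_id] at h1
    have h2 := congrArg (fun x => (extBasis K n).repr x I) h1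
    rw [map_smul, Finsupp.smul_apply, extBasis_repr_map_diagonal (dualAct_single hne hσa),
      smul_eq_mul, ← mul_assoc] at h2
    have h3 := mul_right_cancel₀ h ((one_mul _).trans h2)
    rw [← prod_inv_pow_eq_one_iff, h3]
    simp only [hδ, pow_add, Finset.prod_mul_distrib]
    congr 1
    rw [← Finset.prod_subset (Finset.subset_univ I)]
    · exact Finset.prod_congr rfl fun i hi => by simp [hi]
    · intro i _ hi; simp [hi])
  obtain ⟨h1, h2⟩ := hchar
  have hm := hP.m_pos
  by_cases h0 : ∃ i, δ i = 0
  · obtain ⟨i, hi⟩ := h0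
    by_cases hj : ∃ j, δ j ≠ 0
    · obtain ⟨j, hj⟩ := hj
      left; left
      refine ⟨j, ?_⟩
      have h3 := h1 j i
      rw [hi, Nat.cast_zero, sub_zero, Int.natCast_dvd_natCast] at h3
      have h4 := Nat.le_of_dvd (Nat.pos_of_ne_zero hj) h3
      simp only [hδ] at h4
      split_ifs at h4 <;> omega
    · push Not at hj
      right
      constructor
      · ext i; have := hj i; simp only [hδ] at this; simp; omega
      · ext i; have := hj i; simp only [hδ] at this
        by_cases hi : i ∈ I
        · simp [hi] at this
        · simp [hi]
  · push Not at h0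
    left
    have hge : ∀ i, q ≤ δ i := fun i =>
      Nat.le_of_dvd (Nat.pos_of_ne_zero (h0 i)) (Int.natCast_dvd_natCast.1 (h2 i))
    by_cases hI : ∃ i ∈ I, ∃ j ∈ I, i ≠ j
    · obtain ⟨i, hi, j, hj, hij⟩ := hI
      left
      -- Equal exponents contradict antisymmetry under the transposition of `i` and `j`. Unequal
      -- ones differ by a non-zero multiple of `m`, so the larger is at least `m`.
      by_cases hα : α i = α j
      · exfalso
        obtain ⟨σ, hσ, hσs⟩ := exists_swap_mem (K := K) (p := p) hP.m_pos i j
        have h3 := formCoeff_formAct_swap hσs hα ω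
        rw [hω σ hσ] at h3
        have h4 := extBasis_repr_map_swap (f := dualAct σ) hij
          (fun k => by simpa using dualAct_single (fun _ => one_ne_zero) hσs k)
          (formCoeff α ω) hi hj
        rw [← h3, self_eq_neg] at h4
        exact h h4
      · have h3 := h1 i j
        simp only [hδ, hi, hj, if_true] at h3
        push_cast at h3
        rw [add_sub_add_right_eq_sub] at h3
        have h4 := Int.le_of_dvd (by have : (α i : ℤ) ≠ α j := by exact_mod_cast hα
                                     exact abs_pos.2 (sub_ne_zero.2 this)) ((dvd_abs _ _).2 h3)
        rcases abs_cases ((α i : ℤ) - α j) with h5 | h5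
        · exact ⟨i, by omega⟩
        · exact ⟨j, by omega⟩
    · push Not at hI
      right
      -- Here `I` has at most one element, so passing from `δ` to `α` loses at most one unit, at one
      -- index. For empty `I` any index serves.
      obtain ⟨j, hj⟩ : ∃ j, ∀ i ∈ I, i = j := by
        rcases I.eq_empty_or_nonempty with rfl | ⟨j, hj⟩
        · exact ⟨⟨0, by have := hP.two_le_n; omega⟩, by simp⟩
        · exact ⟨j, fun i hi => hI i hi j hj⟩
      refine ⟨j, fun i => ?_⟩
      have h3 := hge i
      simp only [hδ] at h3
      by_cases hi : i ∈ I
      · rw [if_pos (hj i hi)]; rw [if_pos hi] at h3; omega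
      · rw [if_neg hi] at h3; split_ifs <;> omega

/-- Only a constant term could escape the upper set. It would be a scalar of `x`-degree 0, hence of
positive `θ`-degree, hence zero. -/
theorem formCoeff_eq_zero_of_invariant (hP : IsGenericParams m p q n) {ζ : K}
    (hζ : IsPrimitiveRoot ζ m) {ω : Forms K n} (hω : ∀ σ ∈ Gmpn K m p n, formAct σ ω = ω)
    {i k : ℕ} (hik : 0 < i + k) (hb : ω ∈ bidegree K n i k) {α : Fin n →₀ ℕ}
    (hα : α ∉ jacobianExponents m q n) : formCoeff α ω = 0 := by
  have hI : ∀ I, (extBasis K n).repr (formCoeff α ω) I ≠ 0 → α = 0 ∧ I = ∅ := fun I hI =>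
    (formCoeff_repr_ne_zero hP hζ hω hI).resolve_left hα
  obtain ⟨h1, h2⟩ := formCoeff_mem_of_mem_bidegree hb α
  by_contra hne
  obtain ⟨I, hI0⟩ : ∃ I, (extBasis K n).repr (formCoeff α ω) I ≠ 0 := by
    by_contra! h0
    exact hne ((extBasis K n).repr.map_eq_zero_iff.1 (Finsupp.ext h0))
  have hα0 := (hI I hI0).1
  have hi : i = 0 := by
    by_contra hi
    exact hne (h2 (by rw [hα0, map_zero]; exact Ne.symm hi))
  have hsc : formCoeff α ω = algebraMap K _ ((extBasis K n).repr (formCoeff α ω) ∅) := by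
    rw [Algebra.algebraMap_eq_smul_one, ← extBasis_empty]
    apply (extBasis K n).repr.injective
    rw [map_smul, Module.Basis.repr_self]
    ext J
    by_cases hJ : J = ∅
    · simp [hJ]
    · rw [Finsupp.smul_apply, Finsupp.single_eq_of_ne hJ, smul_zero]
      by_contra h0
      exact hJ (hI J fun h1 => h0 (by rw [h1])).2
  rw [hsc] at h1
  have h3 := eq_zero_of_algebraMap_mem_exteriorPower (by omega) h1
  rw [h3, map_zero] at hsc
  exact hne hsc

theorem superCoinvariantIdeal_le (hP : IsGenericParams m p q n) {ζ : K}
    (hζ : IsPrimitiveRoot ζ m) :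
    superCoinvariantIdeal (Gmpn K m p n)
      ≤ exponentIdeal K (jacobianExponents m q n) (isUpperSet_jacobianExponents m q n) := by
  rw [superCoinvariantIdeal, TwoSidedIdeal.span_le]
  rintro ω ⟨hω, i, k, hik, hb⟩
  exact mem_exponentIdeal.2 fun α hα => formCoeff_eq_zero_of_invariant hP hζ hω hik hb hα

/-! ### Two invariant 1-forms and the top-degree super harmonics. -/

theorem formAct_sum_formsBasis {σ : GL (Fin n) K} {π : Equiv.Perm (Fin n)} {a : Fin n → K}
    (ha : ∀ i, a i ≠ 0) (hσ : (σ : Matrix (Fin n) (Fin n) K) = monomialMatrix π a)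
    (γ : Fin n → Fin n →₀ ℕ) (hγ : ∀ i, (γ i).mapDomain π = γ (π i))
    (hγa : ∀ i, (∏ k, (a k)⁻¹ ^ γ i k) * (a i)⁻¹ = 1) :
    formAct σ (∑ i, formsBasis K n (γ i, {i})) = ∑ i, formsBasis K n (γ i, {i}) := by
  rw [map_sum, ← Equiv.sum_comp π fun i => formsBasis K n (γ i, {i})]
  refine Finset.sum_congr rfl fun i _ => ?_
  rw [formsBasis_apply, formsBasis_apply, formAct, Algebra.TensorProduct.map_tmul,
    polyAct_monomial ha hσ, hγ, extBasis_singleton, ExteriorAlgebra.map_apply_ι,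
    dualAct_single ha hσ, map_smul, TensorProduct.tmul_smul, TensorProduct.smul_tmul',
    MvPolynomial.smul_monomial, extBasis_singleton, smul_eq_mul, mul_one, mul_comm, hγa]

theorem sum_formsBasis_mem (γ : Fin n → Fin n →₀ ℕ) {d : ℕ} (hd : ∀ i, (γ i).degree = d) :
    ∑ i, formsBasis K n (γ i, {i}) ∈ bidegree K n d 1 := by
  refine Submodule.sum_mem _ fun i _ => ?_
  rw [formsBasis_apply, extBasis_singleton]
  refine tmul_mem_bidegree (MvPolynomial.isHomogeneous_monomial _ (hd i)) ?_
  rw [ExteriorAlgebra.exteriorPower, pow_one]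
  exact ⟨_, rfl⟩

/-- The exponents of `∂_{x_j} (x_1 ⋯ x_n)^q`. -/
def jacobianExponentFull (q : ℕ) (j : Fin n) : Fin n →₀ ℕ :=
  Finsupp.equivFunOnFinite.symm fun i => if i = j then q - 1 else q

theorem jacobianExponentFull_apply (q : ℕ) (j i : Fin n) :
    jacobianExponentFull q j i = if i = j then q - 1 else q := rfl

/-- Up to the factor `m`, this form is the differential of `∑ x_i^m`. -/
theorem sum_formsBasis_single_invariant (hP : IsGenericParams m p q n) {σ : GL (Fin n) K}
    (hσ : σ ∈ Gmpn K m p n) :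
    formAct σ (∑ i : Fin n, formsBasis K n (Finsupp.single i (m - 1), {i}))
      = ∑ i : Fin n, formsBasis K n (Finsupp.single i (m - 1), {i}) := by
  obtain ⟨π, a, ha, ha', hσa⟩ := hσ
  refine formAct_sum_formsBasis (ne_zero_of_pow_eq_one hP.m_pos ha) hσa _
    (fun i => by rw [Finsupp.mapDomain_single]) fun i => ?_
  rw [Finset.prod_eq_single i (fun k _ hk => by rw [Finsupp.single_eq_of_ne hk, pow_zero])
    (by simp), Finsupp.single_eq_same, ← pow_succ, Nat.sub_add_cancel hP.m_pos, inv_pow, ha,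
    inv_one]

/-- Up to the factor `q`, this form is the differential of `(x_1 ⋯ x_n)^q`. -/
theorem sum_formsBasis_full_invariant (hP : IsGenericParams m p q n) {σ : GL (Fin n) K}
    (hσ : σ ∈ Gmpn K m p n) :
    formAct σ (∑ i : Fin n, formsBasis K n (jacobianExponentFull q i, {i}))
      = ∑ i : Fin n, formsBasis K n (jacobianExponentFull q i, {i}) := by
  obtain ⟨π, a, ha, ha', hσa⟩ := hσ
  refine formAct_sum_formsBasis (ne_zero_of_pow_eq_one hP.m_pos ha) hσa _ (fun i => ?_)
    fun i => ?_
  · ext k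
    rw [Finsupp.mapDomain_equiv_apply, jacobianExponentFull_apply, jacobianExponentFull_apply]
    simp only [Equiv.symm_apply_eq]
  · rw [← Finset.mul_prod_erase _ _ (Finset.mem_univ i), jacobianExponentFull_apply,
      if_pos rfl, mul_right_comm, ← pow_succ, Nat.sub_add_cancel hP.q_pos,
      Finset.prod_congr rfl (g := fun k => (a k)⁻¹ ^ q) (fun k hk => by
        rw [jacobianExponentFull_apply, if_neg (Finset.ne_of_mem_erase hk)]),
      Finset.mul_prod_erase Finset.univ (fun k => (a k)⁻¹ ^ q) (Finset.mem_univ i),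
      Finset.prod_pow, Finset.prod_inv_distrib, inv_pow, ← hP.div_eq, ha', inv_one]

section Conj
variable [ConjClosed K]

/-- The top-degree super harmonics of `G(m, p, n)`. -/
theorem tmul_topForm_mem_superHarmonics_iff (hP : IsGenericParams m p q n) {ζ : K}
    (hζ : IsPrimitiveRoot ζ m) (h : MvPolynomial (Fin n) K) :
    h ⊗ₜ[K] topForm K n ∈ superHarmonics (Gmpn K m p n)
      ↔ ∀ α ∈ jacobianExponents m q n, h.coeff α = 0 := by
  constructor
  · intro H α hα
    -- The two invariant 1-forms supply exactly the operators `∂^γ` with `γ` a generator of the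
    -- upper set.
    have key : ∀ (γ : Fin n → Fin n →₀ ℕ) (d : ℕ), (∀ i, (γ i).degree = d) →
        (∀ σ ∈ Gmpn K m p n, formAct σ (∑ i, formsBasis K n (γ i, {i}))
          = ∑ i, formsBasis K n (γ i, {i})) → ∀ j, polyDiffMonomial (γ j) h = 0 := by
      intro γ d hd hγ j
      exact polyDiffMonomial_eq_zero_of_formDiff γ (H _ (TwoSidedIdeal.subset_span
        ⟨hγ, d, 1, by omega, sum_formsBasis_mem γ hd⟩)) j
    rcases hα with ⟨i, hi⟩ | ⟨j, hj⟩
    · refine coeff_eq_zero_of_polyDiffMonomial_eq_zero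
        (key (fun i => Finsupp.single i (m - 1)) (m - 1)
        (fun i => Finsupp.degree_single i (m - 1))
          (fun σ hσ => sum_formsBasis_single_invariant hP hσ) i) ?_
      simpa using hi
    · refine coeff_eq_zero_of_polyDiffMonomial_eq_zero
        (key (jacobianExponentFull q) (q - 1 + (n - 1) * q) (fun i => ?_)
          (fun σ hσ => sum_formsBasis_full_invariant hP hσ) j) (fun i => hj i)
      rw [Finsupp.degree_eq_sum, ← Finset.add_sum_erase _ _ (Finset.mem_univ i),
        jacobianExponentFull_apply, if_pos rfl,
        Finset.sum_congr rfl (g := fun _ => q) (fun k hk => by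
          rw [jacobianExponentFull_apply, if_neg (Finset.ne_of_mem_erase hk)])]
      simp
  · intro H ω hω
    -- Every `x`-exponent `α` of an element of the ideal lies in the upper set, hence so does every
    -- `β ≥ α`.
    refine formDiff_tmul_eq_zero fun α hα => polyDiffMonomial_eq_zero fun β hβ => H β ?_
    refine isUpperSet_jacobianExponents m q n hβ ?_
    by_contra hn
    exact hα (mem_exponentIdeal.1 (superCoinvariantIdeal_le hP hζ hω) α hn)

end Conj

/-! ### Semi-invariant polynomials -/

theorem det_ne_zero_of_gl (σ : GL (Fin n) K) : (σ : Matrix (Fin n) (Fin n) K).det ≠ 0 :=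
  σ.det_ne_zero

theorem sign_mul_self (π : Equiv.Perm (Fin n)) :
    ((Equiv.Perm.sign π : ℤ) : K) * ((Equiv.Perm.sign π : ℤ) : K) = 1 := by
  rw [← Int.cast_mul, ← Units.val_mul, Int.units_mul_self]; simp

/-- Comparing coefficients under a diagonal matrix shows that the character with exponents `α_i + s`
is trivial; the shift `s` comes from `det ^ s`. -/
theorem exponents_of_semiinvariant (hP : IsGenericParams m p q n) {ζ : K}
    (hζ : IsPrimitiveRoot ζ m) {s : ℕ} {h : MvPolynomial (Fin n) K}
    (hh : ∀ σ ∈ Gmpn K m p n, polyAct σ h = ((σ : Matrix (Fin n) (Fin n) K).det ^ s) • h)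
    {α : Fin n →₀ ℕ} (hα : h.coeff α ≠ 0) :
    (∀ i j, (m : ℤ) ∣ (α i : ℤ) - α j) ∧ ∀ i, q ∣ α i + s := by
  have hchar := exponents_of_trivial_character (δ := fun i => ((α i + s : ℕ) : ℤ)) hP hζ (by
    intro a ha ha'
    obtain ⟨σ, hσ, hσa⟩ := exists_mem_Gmpn hP.m_pos 1 ha ha'
    have hne := ne_zero_of_pow_eq_one hP.m_pos ha
    have h1 := coeff_polyAct hne hσa α h
    rw [hh σ hσ, Equiv.Perm.coe_one, Finsupp.mapDomain_id, MvPolynomial.coeff_smul,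
      smul_eq_mul] at h1
    have h2 := mul_right_cancel₀ hα h1
    rw [hσa, det_monomialMatrix] at h2
    rw [← prod_inv_pow_eq_one_iff]
    simp only [pow_add, Finset.prod_mul_distrib]
    rw [← h2, Finset.prod_pow, ← mul_pow, Equiv.Perm.sign_one]
    simp only [Units.val_one, Int.cast_one, mul_one, Finset.prod_inv_distrib]
    rw [mul_inv_cancel₀ (Finset.prod_ne_zero_iff.2 fun i _ => hne i), one_pow])
  refine ⟨fun i j => ?_, fun i => Int.natCast_dvd_natCast.1 (hchar.2 i)⟩
  have := hchar.1 i j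
  push_cast at this
  rwa [add_sub_add_right_eq_sub] at this

theorem formAct_tmul_topForm_of_mem (hm : 0 < m) {σ : GL (Fin n) K}
    (hσ : σ ∈ Gmpn K m p n) (h : MvPolynomial (Fin n) K) :
    formAct σ (h ⊗ₜ[K] topForm K n)
      = ((σ : Matrix (Fin n) (Fin n) K).det⁻¹ • polyAct σ h) ⊗ₜ[K] topForm K n := by
  obtain ⟨π, a, ha, _, hσa⟩ := hσ
  rw [formAct_tmul_topForm (ne_zero_of_pow_eq_one hm ha) hσa, hσa, det_monomialMatrix,
    mul_inv, Finset.prod_inv_distrib, inv_eq_of_mul_eq_one_left (sign_mul_self π),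
    TensorProduct.smul_tmul']

theorem tmul_topForm_injective {g h : MvPolynomial (Fin n) K}
    (H : g ⊗ₜ[K] topForm K n = h ⊗ₜ[K] topForm K n) : g = h := by
  ext α
  have := congrArg (formCoeff α) H
  rw [formCoeff_tmul, formCoeff_tmul] at this
  exact congrArg Subtype.val (smul_left_injective K topForm_ne_zero this)

/-- The top form has character `det⁻¹`, which is why `det²` and `Γ_G` govern the `det` part in top
degree. -/
theorem formAct_tmul_topForm_eq_det_iff (hm : 0 < m) {σ : GL (Fin n) K}
    (hσ : σ ∈ Gmpn K m p n) (h : MvPolynomial (Fin n) K) :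
    formAct σ (h ⊗ₜ[K] topForm K n)
        = (σ : Matrix (Fin n) (Fin n) K).det • h ⊗ₜ[K] topForm K n
      ↔ polyAct σ h = ((σ : Matrix (Fin n) (Fin n) K).det ^ 2) • h := by
  have hd := det_ne_zero_of_gl σ
  rw [formAct_tmul_topForm_of_mem hm hσ, TensorProduct.smul_tmul']
  constructor
  · intro H
    have := tmul_topForm_injective H
    rw [sq, mul_smul, ← this, smul_smul, mul_inv_cancel₀ hd, one_smul]
  · intro H
    rw [H, smul_smul, sq, ← mul_assoc, inv_mul_cancel₀ hd, one_mul]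

/-- The exponent `(t, …, t)`. -/
def constExponent (n t : ℕ) : Fin n →₀ ℕ := Finsupp.equivFunOnFinite.symm fun _ => t

@[simp]
theorem constExponent_apply (t : ℕ) (i : Fin n) : constExponent n t i = t := rfl

theorem polyAct_constExponent {σ : GL (Fin n) K} {π : Equiv.Perm (Fin n)} {a : Fin n → K}
    (ha : ∀ i, a i ≠ 0) (hσ : (σ : Matrix (Fin n) (Fin n) K) = monomialMatrix π a) (t : ℕ) :
    polyAct σ (MvPolynomial.monomial (constExponent n t) 1)
      = ((∏ i, a i)⁻¹ ^ t) • MvPolynomial.monomial (constExponent n t) 1 := by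
  have : (constExponent n t).mapDomain π = constExponent n t := by
    ext k; rw [Finsupp.mapDomain_equiv_apply]; simp
  rw [polyAct_monomial ha hσ, this, MvPolynomial.smul_monomial, smul_eq_mul]
  simp only [constExponent_apply, Finset.prod_pow, Finset.prod_inv_distrib]

theorem polyAct_gamma (hP : IsGenericParams m p q n) {σ : GL (Fin n) K}
    (hσ : σ ∈ Gmpn K m p n) :
    polyAct σ (MvPolynomial.monomial (constExponent n (q - 2)) (1 : K))
      = ((σ : Matrix (Fin n) (Fin n) K).det ^ 2) •
        MvPolynomial.monomial (constExponent n (q - 2)) (1 : K) := by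
  obtain ⟨π, a, ha, ha', hσa⟩ := hσ
  have hne := ne_zero_of_pow_eq_one hP.m_pos ha
  have h0 : (∏ i, a i) ≠ 0 := Finset.prod_ne_zero_iff.2 fun i _ => hne i
  rw [hP.div_eq] at ha'
  rw [polyAct_constExponent hne hσa, hσa, det_monomialMatrix, mul_pow, sq ((_ : ℤ) : K),
    sign_mul_self, mul_one, inv_pow]
  congr 1
  refine inv_eq_of_mul_eq_one_right ?_
  rw [← pow_add]
  have := hP.q_pos
  -- For `q = 1` the truncated exponent `q - 2` is 0, but the product of the entries is 1, so both
  -- characters are trivial.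
  by_cases hq : q = 1
  · subst hq
    rw [pow_one] at ha'
    rw [ha', one_pow]
  · rw [show q - 2 + 2 = q by omega, ha']

theorem constExponent_notMem (hP : IsGenericParams m p q n) :
    constExponent n (q - 2) ∉ jacobianExponents m q n := by
  have h1 := hP.two_mul_q_le
  have h2 := hP.q_pos
  have h3 := hP.two_le_n
  have h4 := hP.three_le_m
  rintro (⟨i, hi⟩ | ⟨j, hj⟩)
  · rw [constExponent_apply] at hi; omega
  · obtain ⟨i, hi⟩ : ∃ i, i ≠ j := by
      have : Nontrivial (Fin n) := Fin.nontrivial_iff_two_le.2 h3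
      exact exists_ne j
    have := hj i
    rw [if_neg hi, constExponent_apply] at this
    omega

/-- Off the upper set all entries are below `m - 1`; being congruent modulo `m`, they are equal.
Their common value `t` is below `q`, and `q ∣ t + 2` leaves only `t = q - 2`, or `t = 0` when `q =
1`. -/
theorem eq_monomial_of_det_sq (hP : IsGenericParams m p q n) {ζ : K}
    (hζ : IsPrimitiveRoot ζ m) {h : MvPolynomial (Fin n) K}
    (hh : ∀ σ ∈ Gmpn K m p n, polyAct σ h = ((σ : Matrix (Fin n) (Fin n) K).det ^ 2) • h)
    (hU : ∀ α ∈ jacobianExponents m q n, h.coeff α = 0) :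
    h = MvPolynomial.monomial (constExponent n (q - 2))
      (h.coeff (constExponent n (q - 2))) := by
  have key : ∀ α, h.coeff α ≠ 0 → α = constExponent n (q - 2) := by
    intro α hα
    obtain ⟨h1, h2⟩ := exponents_of_semiinvariant hP hζ hh hα
    have hαU : α ∉ jacobianExponents m q n := fun hmem => hα (hU α hmem)
    simp only [jacobianExponents, Set.mem_ofPred_eq, not_or, not_exists, not_le] at hαU
    have heq : ∀ i j, α i = α j := by
      intro i j
      have := Int.eq_zero_of_abs_lt_dvd (h1 i j) (by
        have := hαU.1 i
        have := hαU.1 j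
        rw [abs_lt]; constructor <;> omega)
      omega
    ext i
    rw [constExponent_apply]
    have hq := hP.q_pos
    have hlt : α i < q := by
      by_contra hge
      refine hαU.2 ⟨0, by have := hP.two_le_n; omega⟩ fun j => ?_
      rw [← heq i j]
      split_ifs <;> omega
    obtain ⟨c, hc⟩ := h2 i
    have hc2 : c ≤ 2 ∨ q = 1 := by
      by_contra! hcc
      have : q * 3 ≤ q * c := Nat.mul_le_mul_left q (by omega)
      omega
    by_cases hq1 : q = 1
    · omega
    · have hc2 := hc2.resolve_right hq1
      interval_cases c
      all_goals omega
  ext α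
  rw [MvPolynomial.coeff_monomial]
  split_ifs with hα
  · rw [hα]
  · by_contra hne
    exact hα (key α fun h0 => hne (by rw [h0])).symm

/-- The exponent of a monomial of large degree outside the Jacobian ideal. -/
def witnessExponent (m q n : ℕ) : Fin n →₀ ℕ :=
  Finsupp.equivFunOnFinite.symm fun i => if (i : ℕ) + 2 < n then m - 2 else q - 1

theorem witnessExponent_apply (m q : ℕ) (i : Fin n) :
    witnessExponent m q n i = if (i : ℕ) + 2 < n then m - 2 else q - 1 := rfl

/-- Two entries equal `q - 1`, whereas a generator of the second kind tolerates only one entry below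
`q`. -/
theorem witnessExponent_notMem (hP : IsGenericParams m p q n) :
    witnessExponent m q n ∉ jacobianExponents m q n := by
  have h1 := hP.two_mul_q_le
  have h2 := hP.q_pos
  have h3 := hP.two_le_n
  have h4 := hP.three_le_m
  rintro (⟨i, hi⟩ | ⟨j, hj⟩)
  · rw [witnessExponent_apply] at hi; split_ifs at hi <;> omega
  · have ha := hj ⟨n - 1, by omega⟩
    have hb := hj ⟨n - 2, by omega⟩
    rw [witnessExponent_apply] at ha hb
    simp only [Fin.ext_iff] at ha hb
    split_ifs at ha hb <;> omega

theorem le_witnessExponent (hP : IsGenericParams m p q n) (i : Fin n) :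
    q - 2 ≤ witnessExponent m q n i := by
  have h1 := hP.two_mul_q_le
  rw [witnessExponent_apply]; split_ifs <;> omega

/-- The genericity conditions are needed here. For `n = 2` the entry is `q - 1`, and `q ≥ 2` because
`G(m,m,2)` is excluded. For `n ≥ 3` it is `m - 2`, positive since `m ≥ 3`, which settles `q = 1`. -/
theorem lt_witnessExponent (hP : IsGenericParams m p q n) (i : Fin n) (hi : (i : ℕ) = 0) :
    q - 2 < witnessExponent m q n i := by
  have h1 := hP.two_mul_q_le
  have h2 := hP.q_pos
  have h3 := hP.two_le_n
  have h4 := hP.three_le_m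
  have h5 := hP.three_le_n
  rw [witnessExponent_apply, hi]; split_ifs <;> omega

theorem lt_degree_witnessExponent (hP : IsGenericParams m p q n) :
    n * (q - 2) < (witnessExponent m q n).degree := by
  rw [Finsupp.degree_eq_sum]
  calc n * (q - 2) = ∑ _i : Fin n, (q - 2) := by simp
    _ < _ := Finset.sum_lt_sum (fun i _ => le_witnessExponent hP i)
      ⟨⟨0, by have := hP.two_le_n; omega⟩, Finset.mem_univ _, lt_witnessExponent hP _ rfl⟩

/-! ### The coinvariant and Jacobian ideals -/

/-- The exponents of positive degree that can occur in an invariant polynomial. -/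
def invariantExponents (m q n : ℕ) : Set (Fin n →₀ ℕ) :=
  {α | (∃ i, m ≤ α i) ∨ ∀ i, q ≤ α i}

theorem isUpperSet_invariantExponents (m q n : ℕ) : IsUpperSet (invariantExponents m q n) := by
  rintro α β hαβ (⟨i, hi⟩ | hj)
  · exact Or.inl ⟨i, hi.trans (hαβ i)⟩
  · exact Or.inr fun i => (hj i).trans (hαβ i)

theorem mem_invariantExponents_of_invariant (hP : IsGenericParams m p q n) {ζ : K}
    (hζ : IsPrimitiveRoot ζ m) {h : MvPolynomial (Fin n) K}
    (hh : h ∈ polyInvariants (Gmpn K m p n)) {α : Fin n →₀ ℕ} (hα : h.coeff α ≠ 0)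
    (hα0 : α ≠ 0) : α ∈ invariantExponents m q n := by
  obtain ⟨h1, h2⟩ := exponents_of_semiinvariant (s := 0) hP hζ
    (fun σ hσ => by rw [pow_zero, one_smul]; exact hh σ hσ) hα
  by_cases h0 : ∃ i, α i = 0
  · obtain ⟨i, hi⟩ := h0
    obtain ⟨j, hj⟩ := Finsupp.ne_iff.1 hα0
    left
    refine ⟨j, Nat.le_of_dvd (Nat.pos_of_ne_zero hj) ?_⟩
    have := h1 j i
    rw [hi, Nat.cast_zero, sub_zero] at this
    exact Int.natCast_dvd_natCast.1 this
  · push Not at h0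
    exact Or.inr fun i => Nat.le_of_dvd (Nat.pos_of_ne_zero (h0 i)) (h2 i)

theorem coinvariantIdeal_le (hP : IsGenericParams m p q n) {ζ : K} (hζ : IsPrimitiveRoot ζ m) :
    coinvariantIdeal (Gmpn K m p n)
      ≤ exponentIdealPoly K (invariantExponents m q n) (isUpperSet_invariantExponents m q n) := by
  rw [coinvariantIdeal, Ideal.span_le]
  rintro g ⟨hg, d, hd, hgd⟩ α hα
  by_contra hne
  refine hα (mem_invariantExponents_of_invariant hP hζ hg hne ?_)
  rintro rfl
  exact hne (hgd.coeff_eq_zero (by rw [map_zero]; omega))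

/-- A derivative lowers one entry of an exponent by one, which carries `invariantExponents` into
`jacobianExponents`. -/
theorem jacobianIdeal_le (hP : IsGenericParams m p q n) {ζ : K} (hζ : IsPrimitiveRoot ζ m)
    {f : Fin n → MvPolynomial (Fin n) K} (hf : IsBasicInvariants (Gmpn K m p n) f) :
    jacobianIdeal f
      ≤ exponentIdealPoly K (jacobianExponents m q n) (isUpperSet_jacobianExponents m q n) := by
  rw [jacobianIdeal, Ideal.span_le]
  rintro _ ⟨⟨i, j⟩, rfl⟩ α hα
  by_contra hne
  rw [MvPolynomial.coeff_pderiv] at hne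
  have hfi : f i ∈ polyInvariants (Gmpn K m p n) := by
    rw [← hf.adjoin_eq]; exact Algebra.subset_adjoin ⟨i, rfl⟩
  rcases mem_invariantExponents_of_invariant hP hζ hfi (left_ne_zero_of_mul hne) (by
    intro h0
    have := DFunLike.congr_fun h0 j
    simp at this) with ⟨k, hk⟩ | hk
  · refine hα (Or.inl ⟨k, ?_⟩)
    rw [Finsupp.add_apply, Finsupp.single_apply] at hk
    split_ifs at hk <;> omega
  · refine hα (Or.inr ⟨j, fun k => ?_⟩)
    have := hk k
    rw [Finsupp.add_apply, Finsupp.single_apply] at this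
    split_ifs at this ⊢ with h1 h2 h2
    · omega
    · exact absurd h1.symm h2
    · exact absurd h2.symm h1
    · omega

/-- By the Leibniz rule the ideal contains the derivatives of all invariants, so the choice of basic
invariants is immaterial. -/
theorem pderiv_mem_jacobianIdeal {G : Subgroup (GL (Fin n) K)}
    {f : Fin n → MvPolynomial (Fin n) K} (hf : IsBasicInvariants G f)
    {g : MvPolynomial (Fin n) K} (hg : g ∈ polyInvariants G) (j : Fin n) :
    MvPolynomial.pderiv j g ∈ jacobianIdeal f := by
  rw [← hf.adjoin_eq] at hg
  induction hg using Algebra.adjoin_induction with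
  | mem x hx => obtain ⟨i, rfl⟩ := hx; exact Ideal.subset_span ⟨(i, j), rfl⟩
  | algebraMap r => rw [Derivation.map_algebraMap]; exact zero_mem _
  | add x y _ _ hx hy => rw [map_add]; exact add_mem hx hy
  | mul x y _ _ hx hy =>
    rw [MvPolynomial.pderiv_mul]
    exact add_mem (Ideal.mul_mem_right _ _ hx) (Ideal.mul_mem_left _ _ hy)

theorem sum_monomial_single_mem_polyInvariants (hm : 0 < m) :
    ∑ i : Fin n, MvPolynomial.monomial (Finsupp.single i m) (1 : K)
      ∈ polyInvariants (Gmpn K m p n) := by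
  rintro σ ⟨π, a, ha, -, hσa⟩
  rw [map_sum, ← Equiv.sum_comp π fun i => MvPolynomial.monomial (Finsupp.single i m) (1 : K)]
  refine Finset.sum_congr rfl fun i _ => ?_
  rw [polyAct_monomial (ne_zero_of_pow_eq_one hm ha) hσa, Finsupp.mapDomain_single,
    Finset.prod_eq_single i (fun k _ hk => by rw [Finsupp.single_eq_of_ne hk, pow_zero])
    (by simp), Finsupp.single_eq_same, inv_pow, ha, inv_one, one_mul]

theorem monomial_constExponent_mem_polyInvariants (hP : IsGenericParams m p q n) :
    MvPolynomial.monomial (constExponent n q) (1 : K) ∈ polyInvariants (Gmpn K m p n) := by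
  rintro σ ⟨π, a, ha, ha', hσa⟩
  rw [polyAct_constExponent (ne_zero_of_pow_eq_one hP.m_pos ha) hσa, inv_pow, ← hP.div_eq, ha',
    inv_one, one_smul]

theorem monomial_mem_of_le {J : Ideal (MvPolynomial (Fin n) K)} {α β : Fin n →₀ ℕ} {c : K}
    (hc : c ≠ 0) (h : MvPolynomial.monomial α c ∈ J) (hαβ : α ≤ β) :
    MvPolynomial.monomial β 1 ∈ J := by
  have := J.mul_mem_left (MvPolynomial.monomial (β - α) c⁻¹) h
  rwa [MvPolynomial.monomial_mul, tsub_add_cancel_of_le hαβ, inv_mul_cancel₀ hc] at this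

theorem monomial_mem_jacobianIdeal (hP : IsGenericParams m p q n)
    {f : Fin n → MvPolynomial (Fin n) K} (hf : IsBasicInvariants (Gmpn K m p n) f)
    {α : Fin n →₀ ℕ} (hα : α ∈ jacobianExponents m q n) :
    MvPolynomial.monomial α 1 ∈ jacobianIdeal f := by
  rcases hα with ⟨i, hi⟩ | ⟨j, hj⟩
  · have h := pderiv_mem_jacobianIdeal hf (sum_monomial_single_mem_polyInvariants hP.m_pos) i
    rw [map_sum, Finset.sum_eq_single i (fun k _ hk => by
      rw [MvPolynomial.pderiv_monomial, Finsupp.single_eq_of_ne (Ne.symm hk)]; simp) (by simp),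
      MvPolynomial.pderiv_monomial, Finsupp.single_eq_same] at h
    refine monomial_mem_of_le ?_ h ?_
    · rw [one_mul]; exact Nat.cast_ne_zero.2 hP.m_pos.ne'
    · rw [← Finsupp.single_tsub]; simpa using hi
  · have h := pderiv_mem_jacobianIdeal hf (monomial_constExponent_mem_polyInvariants hP) j
    rw [MvPolynomial.pderiv_monomial] at h
    refine monomial_mem_of_le ?_ h fun i => ?_
    · rw [one_mul, constExponent_apply]; exact Nat.cast_ne_zero.2 hP.q_pos.ne'
    · have := hj i
      rw [Finsupp.tsub_apply, constExponent_apply, Finsupp.single_apply]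
      split_ifs at this ⊢ with h1 h2 h2
      · omega
      · exact absurd h1.symm h2
      · exact absurd h2.symm h1
      · omega

/-! ### The rank and the element `Γ` -/

/-- A fixed vector has zero `i`th coordinate because `diag(…, ζ, …, ζ⁻¹, …)` scales that coordinate
by `ζ ≠ 1`. -/
theorem groupRank_eq (hP : IsGenericParams m p q n) {ζ : K} (hζ : IsPrimitiveRoot ζ m) :
    groupRank (Gmpn K m p n) = n := by
  have hbot : fixedSpace (Gmpn K m p n) = ⊥ := by
    rw [eq_bot_iff]
    intro v hv
    rw [Submodule.mem_bot]
    ext1 i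
    have : Nontrivial (Fin n) := Fin.nontrivial_iff_two_le.2 hP.two_le_n
    obtain ⟨j, hj⟩ := exists_ne i
    have hζ0 : ζ ≠ 0 := hζ.ne_zero hP.m_pos.ne'
    obtain ⟨σ, hσ, hσa⟩ := exists_mem_Gmpn (K := K) (p := p) hP.m_pos 1
      (a := fun k => if k = i then ζ else if k = j then ζ⁻¹ else 1)
      (fun k => by split_ifs <;> simp [hζ.pow_eq_one]) (by
        rw [← Finset.prod_subset (Finset.subset_univ {i, j}), Finset.prod_pair (Ne.symm hj)]
        · simp [hj, hζ0]
        · intro x _ hx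
          simp only [Finset.mem_insert, Finset.mem_singleton, not_or] at hx
          simp [hx.1, hx.2])
    have h1 := congrFun (hv σ hσ) i
    rw [hσa, Matrix.mulVec, dotProduct, Finset.sum_eq_single i (fun k _ hk => by
      simp [monomialMatrix, Ne.symm hk]) (by simp)] at h1
    simp only [monomialMatrix, Matrix.of_apply, Equiv.Perm.coe_one, id_eq, if_true] at h1
    by_contra hne
    exact hζ.ne_one (by have := hP.three_le_m; omega) (mul_right_cancel₀ hne (h1.trans (one_mul _).symm))
  rw [groupRank, hbot, LinearEquiv.finrank_eq (Submodule.quotEquivOfEqBot ⊥ rfl)]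
  simp

theorem monomial_tmul_topForm_ne_zero (α : Fin n →₀ ℕ) :
    MvPolynomial.monomial α (1 : K) ⊗ₜ[K] topForm K n ≠ 0 := by
  rw [← extBasis_univ, ← formsBasis_apply]
  exact (formsBasis K n).ne_zero _

theorem monomial_tmul_topForm_mem_bidegree (α : Fin n →₀ ℕ) :
    MvPolynomial.monomial α (1 : K) ⊗ₜ[K] topForm K n ∈ bidegree K n α.degree n :=
  tmul_mem_bidegree (MvPolynomial.isHomogeneous_monomial _ rfl) topForm_mem_exteriorPower

theorem list_prod_apply_formAct {G : Subgroup (GL (Fin n) K)}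
    {l : List (Module.End K (Forms K n))} (hl : ∀ P ∈ l, P ∈ equivariantOperators G)
    {σ : GL (Fin n) K} (hσ : σ ∈ G) (η : Forms K n) :
    l.prod (formAct σ η) = formAct σ (l.prod η) := by
  induction l with
  | nil => rfl
  | cons P l ih =>
    rw [List.prod_cons, Module.End.mul_apply, Module.End.mul_apply,
      ih fun Q hQ => hl Q (List.mem_cons_of_mem _ hQ), (hl P List.mem_cons_self).2 σ hσ]

section Conj
variable [ConjClosed K]

theorem isGammaElement_monomial (hP : IsGenericParams m p q n) {ζ : K}
    (hζ : IsPrimitiveRoot ζ m) :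
    IsGammaElement (Gmpn K m p n)
      (MvPolynomial.monomial (constExponent n (q - 2)) 1) := by
  refine ⟨⟨fun g hg => polyDiff_eq_zero fun α hα => polyDiffMonomial_eq_zero fun β hβ => ?_,
    fun σ hσ => polyAct_gamma hP hσ⟩, by simp [MvPolynomial.monomial_eq_zero]⟩
  rw [MvPolynomial.coeff_monomial, if_neg]
  rintro rfl
  have hmem : α ∈ invariantExponents m q n := by
    by_contra h
    exact hα (coinvariantIdeal_le hP hζ hg α h)
  have h1 := hP.two_mul_q_le
  have h2 := hP.q_pos
  rcases isUpperSet_invariantExponents m q n hβ hmem with ⟨i, hi⟩ | hi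
  · rw [constExponent_apply] at hi; omega
  · have := hi ⟨0, by have := hP.two_le_n; omega⟩
    rw [constExponent_apply] at this; omega

/-- Equality would make the monomials of `U` annihilate `Γ`, forcing `Γ` to be a multiple of `(x_1 ⋯
x_n)^(q-2)`. A power of `x_1` then annihilates `Γ` too, yet lies outside the ideal because it
divides the witness monomial. -/
theorem annihilatorSet_ne_jacobianIdeal (hP : IsGenericParams m p q n) {ζ : K}
    (hζ : IsPrimitiveRoot ζ m) {f : Fin n → MvPolynomial (Fin n) K}
    (hf : IsBasicInvariants (Gmpn K m p n) f) {Γ : MvPolynomial (Fin n) K}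
    (hΓ : IsGammaElement (Gmpn K m p n) Γ) :
    annihilatorSet Γ ≠ (jacobianIdeal f : Set (MvPolynomial (Fin n) K)) := by
  intro H
  have hU : ∀ α ∈ jacobianExponents m q n, Γ.coeff α = 0 := by
    intro α hα
    have h : MvPolynomial.monomial α 1 ∈ annihilatorSet Γ := by
      rw [H]; exact monomial_mem_jacobianIdeal hP hf hα
    rw [annihilatorSet, Set.mem_ofPred_eq, polyDiff_monomial_one] at h
    exact coeff_eq_zero_of_polyDiffMonomial_eq_zero h le_rfl
  have hΓ' := eq_monomial_of_det_sq hP hζ hΓ.1.2 hU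
  set i : Fin n := ⟨0, by have := hP.two_le_n; omega⟩ with hi
  -- With truncated subtraction, `q - 2 + 1` is `q - 1` for `q ≥ 2` and 1 for `q = 1`.
  have hmem : MvPolynomial.monomial (Finsupp.single i (q - 2 + 1)) 1 ∈ annihilatorSet Γ := by
    rw [annihilatorSet, Set.mem_ofPred_eq, polyDiff_monomial_one]
    refine polyDiffMonomial_eq_zero fun β hβ => ?_
    rw [hΓ', MvPolynomial.coeff_monomial, if_neg]
    rintro rfl
    have := hβ i
    rw [Finsupp.single_eq_same, constExponent_apply] at this
    omega
  rw [H] at hmem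
  have h := jacobianIdeal_le hP hζ hf hmem (Finsupp.single i (q - 2 + 1)) fun h =>
    witnessExponent_notMem hP (isUpperSet_jacobianExponents m q n (by
      rw [Finsupp.single_le_iff]; exact lt_witnessExponent hP i rfl) h)
  rw [MvPolynomial.coeff_monomial, if_pos rfl] at h
  exact one_ne_zero h

/-! ### The top-degree super harmonics -/

theorem exists_eq_of_mem_superHarmonicsDet (hP : IsGenericParams m p q n) {ζ : K}
    (hζ : IsPrimitiveRoot ζ m) {η : Forms K n}
    (hη : η ∈ superHarmonicsDet (Gmpn K m p n) ⊓ thetaDegree K n n) :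
    ∃ c : K, η = MvPolynomial.monomial (constExponent n (q - 2)) c ⊗ₜ[K] topForm K n := by
  obtain ⟨h, rfl⟩ := exists_eq_tmul_topForm hη.2
  have h1 := (tmul_topForm_mem_superHarmonics_iff hP hζ h).1 hη.1.1
  have h2 := eq_monomial_of_det_sq hP hζ
    (fun σ hσ => (formAct_tmul_topForm_eq_det_iff hP.m_pos hσ h).1 (hη.1.2 σ hσ)) h1
  exact ⟨_, by rw [← h2]⟩

theorem monomial_tmul_topForm_mem (hP : IsGenericParams m p q n) {ζ : K}
    (hζ : IsPrimitiveRoot ζ m) {α : Fin n →₀ ℕ} (hα : α ∉ jacobianExponents m q n) :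
    MvPolynomial.monomial α 1 ⊗ₜ[K] topForm K n ∈ superHarmonics (Gmpn K m p n) := by
  rw [tmul_topForm_mem_superHarmonics_iff hP hζ]
  intro β hβ
  rw [MvPolynomial.coeff_monomial, if_neg]
  rintro rfl
  exact hα hβ

theorem superHarmonics_bidegree_ne_bot (hP : IsGenericParams m p q n) {ζ : K}
    (hζ : IsPrimitiveRoot ζ m) {α : Fin n →₀ ℕ} (hα : α ∉ jacobianExponents m q n) :
    superHarmonics (Gmpn K m p n) ⊓ bidegree K n α.degree n ≠ ⊥ :=
  (Submodule.ne_bot_iff _).2 ⟨_, ⟨monomial_tmul_topForm_mem hP hζ hα,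
    monomial_tmul_topForm_mem_bidegree α⟩, monomial_tmul_topForm_ne_zero α⟩

/-- This operator kills the `det` part and commutes with every `∂_ω`, so it detects forms that are
not derivatives of the `det` part. -/
theorem dX_pow_apply_eq_zero (hP : IsGenericParams m p q n) {ζ : K}
    (hζ : IsPrimitiveRoot ζ m) {η : Forms K n}
    (hη : η ∈ superHarmonicsDet (Gmpn K m p n) ⊓ thetaDegree K n n) (i : Fin n)
    (g : Forms K n) : (dX i ^ (q - 2 + 1)) (formDiff g η) = 0 := by
  obtain ⟨c, rfl⟩ := exists_eq_of_mem_superHarmonicsDet hP hζ hη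
  have hc := ((dX_comm_formDiff i g).pow_left (q - 2 + 1)).eq
  rw [← Module.End.mul_apply, hc, Module.End.mul_apply, dX_pow_tmul]
  have h0 : (polyD i ^ (q - 2 + 1)) (MvPolynomial.monomial (constExponent n (q - 2)) c) = 0 := by
    ext γ
    have h1 := multifactorial_mul_coeff_pderiv_pow i (q - 2 + 1) γ
      (MvPolynomial.monomial (constExponent n (q - 2)) c)
    rw [MvPolynomial.coeff_monomial, if_neg, mul_zero] at h1
    · rw [(mul_eq_zero.1 h1).resolve_left (multifactorial_ne_zero γ), MvPolynomial.coeff_zero]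
    · intro h2
      have := DFunLike.congr_fun h2 i
      rw [constExponent_apply, Finsupp.add_apply, Finsupp.single_eq_same] at this
      omega
  rw [h0, TensorProduct.zero_tmul, map_zero]

theorem exists_dX_pow_apply_ne_zero (hP : IsGenericParams m p q n) {ζ : K}
    (hζ : IsPrimitiveRoot ζ m) : ∃ i : Fin n,
    ∃ η ∈ superHarmonics (Gmpn K m p n) ⊓ thetaDegree K n n, (dX i ^ (q - 2 + 1)) η ≠ 0 := by
  set i : Fin n := ⟨0, by have := hP.two_le_n; omega⟩ with hi
  refine ⟨i, _, ⟨monomial_tmul_topForm_mem hP hζ (witnessExponent_notMem hP),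
    tmul_topForm_mem_thetaDegree _⟩, fun h0 => ?_⟩
  rw [dX_pow_tmul] at h0
  have h1 := multifactorial_mul_coeff_pderiv_pow i (q - 2 + 1)
    (witnessExponent m q n - Finsupp.single i (q - 2 + 1))
    (MvPolynomial.monomial (witnessExponent m q n) (1 : K))
  rw [tsub_add_cancel_of_le (by rw [Finsupp.single_le_iff]; exact lt_witnessExponent hP i rfl),
    MvPolynomial.coeff_monomial, if_pos rfl, mul_one,
    tmul_topForm_injective (h0.trans (TensorProduct.zero_tmul _ _).symm),
    MvPolynomial.coeff_zero, mul_zero] at h1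
  exact multifactorial_ne_zero _ h1.symm

theorem superHarmonics_ne_derivativeClosure (hP : IsGenericParams m p q n) {ζ : K}
    (hζ : IsPrimitiveRoot ζ m) :
    superHarmonics (Gmpn K m p n) ⊓ thetaDegree K n n ≠
      derivativeClosure (superHarmonicsDet (Gmpn K m p n) ⊓ thetaDegree K n n) := by
  intro H
  obtain ⟨i, η, hη, hne⟩ := exists_dX_pow_apply_ne_zero hP hζ
  rw [H] at hη
  refine hne ?_
  have hle : derivativeClosure (superHarmonicsDet (Gmpn K m p n) ⊓ thetaDegree K n n)
      ≤ LinearMap.ker (dX i ^ (q - 2 + 1) : Module.End K (Forms K n)) := by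
    rw [derivativeClosure, Submodule.span_le]
    rintro _ ⟨g, ξ, hξ, rfl⟩
    exact LinearMap.mem_ker.2 (dX_pow_apply_eq_zero hP hζ hξ i _)
  exact LinearMap.mem_ker.1 (hle hη)

theorem formDiff_one_tmul_one (η : Forms K n) :
    formDiff ((1 : MvPolynomial (Fin n) K) ⊗ₜ[K] (1 : ExteriorAlgebra K (Fin n → K))) η = η := by
  have : (1 : MvPolynomial (Fin n) K) ⊗ₜ[K] (1 : ExteriorAlgebra K (Fin n → K))
      = formsBasis K n (0, ∅) := by
    rw [formsBasis_apply, extBasis_empty]; rfl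
  rw [this, formDiff_formsBasis, formDiffMonomial]
  simp

theorem superHarmonics_ne_derivatives (hP : IsGenericParams m p q n) {ζ : K}
    (hζ : IsPrimitiveRoot ζ m) {f : Fin n → MvPolynomial (Fin n) K}
    {d : Fin n → Module.End K (Forms K n)} {e : Fin n → ℕ}
    (hd : IsGeneralizedExteriorDerivatives (Gmpn K m p n) f d e) {Δ : MvPolynomial (Fin n) K}
    (hΔ : IsVandermondian (Gmpn K m p n) Δ) :
    ((superHarmonics (Gmpn K m p n) ⊓ thetaDegree K n n : Submodule K (Forms K n)) :
        Set (Forms K n)) ≠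
      {ξ | ∃ (g : MvPolynomial (Fin n) K) (s : Fin n → Fin n),
        ξ = formDiff (g ⊗ₜ[K] 1) ((List.ofFn fun j => d (s j)).prod (Δ ⊗ₜ[K] 1))} := by
  intro H
  -- Taking `g = 1` in the assumed equality makes these elements super harmonic; equivariance of the
  -- `d_i` gives them the character of `Δ`. The previous obstruction then applies.
  have hdet : ∀ s : Fin n → Fin n, (List.ofFn fun j => d (s j)).prod (Δ ⊗ₜ[K] 1)
      ∈ superHarmonicsDet (Gmpn K m p n) ⊓ thetaDegree K n n := by
    intro s
    have hmem : (List.ofFn fun j => d (s j)).prod (Δ ⊗ₜ[K] 1)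
        ∈ superHarmonics (Gmpn K m p n) ⊓ thetaDegree K n n := by
      rw [← SetLike.mem_coe, H]
      exact ⟨1, s, (formDiff_one_tmul_one _).symm⟩
    refine ⟨⟨hmem.1, fun σ hσ => ?_⟩, hmem.2⟩
    rw [← list_prod_apply_formAct (fun P hPm => by
      obtain ⟨j, rfl⟩ := List.mem_ofFn.1 hPm
      exact hd.equivariant _) hσ, formAct, Algebra.TensorProduct.map_tmul, map_one,
      hΔ.1.2 σ hσ, pow_one, ← TensorProduct.smul_tmul', map_smul]
  obtain ⟨i, η, hη, hne⟩ := exists_dX_pow_apply_ne_zero hP hζ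
  rw [← SetLike.mem_coe, H] at hη
  obtain ⟨g, s, rfl⟩ := hη
  exact hne (dX_pow_apply_eq_zero hP hζ (hdet s) i _)

theorem isGreatest_det_degree (hP : IsGenericParams m p q n) {ζ : K}
    (hζ : IsPrimitiveRoot ζ m) :
    IsGreatest {i | superHarmonicsDet (Gmpn K m p n) ⊓ bidegree K n i n ≠ ⊥} (n * (q - 2)) := by
  have hdeg : (constExponent n (q - 2)).degree = n * (q - 2) := by
    rw [Finsupp.degree_eq_sum]; simp
  constructor
  · refine (Submodule.ne_bot_iff _).2 ⟨MvPolynomial.monomial (constExponent n (q - 2)) 1 ⊗ₜ[K]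
      topForm K n, ⟨⟨monomial_tmul_topForm_mem hP hζ (constExponent_notMem hP), fun σ hσ =>
        (formAct_tmul_topForm_eq_det_iff hP.m_pos hσ _).2 (polyAct_gamma hP hσ)⟩, ?_⟩,
      monomial_tmul_topForm_ne_zero _⟩
    have := monomial_tmul_topForm_mem_bidegree (K := K) (constExponent n (q - 2))
    rwa [hdeg] at this
  · intro i hi
    obtain ⟨η, hη, hne⟩ := (Submodule.ne_bot_iff _).1 hi
    obtain ⟨c, rfl⟩ := exists_eq_of_mem_superHarmonicsDet hP hζ
      ⟨hη.1, bidegree_le_thetaDegree _ _ hη.2⟩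
    by_contra hlt
    have h1 := (formCoeff_mem_of_mem_bidegree hη.2 (constExponent n (q - 2))).2
      (by rw [hdeg]; omega)
    rw [formCoeff_tmul, MvPolynomial.coeff_monomial, if_pos rfl] at h1
    have hc := (smul_eq_zero.1 h1).resolve_right topForm_ne_zero
    rw [hc, map_zero, TensorProduct.zero_tmul] at hne
    exact hne rfl

theorem le_of_superHarmonics_bidegree_ne_bot (hP : IsGenericParams m p q n) {ζ : K}
    (hζ : IsPrimitiveRoot ζ m) {i : ℕ}
    (hi : superHarmonics (Gmpn K m p n) ⊓ bidegree K n i n ≠ ⊥) : i ≤ n * (m - 2) := by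
  obtain ⟨η, hη, hne⟩ := (Submodule.ne_bot_iff _).1 hi
  obtain ⟨h, rfl⟩ := exists_eq_tmul_topForm (bidegree_le_thetaDegree _ _ hη.2)
  obtain ⟨α, hα⟩ : ∃ α, formCoeff α (h ⊗ₜ[K] topForm K n) ≠ 0 := by
    by_contra! h0
    exact hne (formCoeff_ext fun α => by rw [h0, map_zero])
  have hdeg : α.degree = i := by
    by_contra hd
    exact hα ((formCoeff_mem_of_mem_bidegree hη.2 α).2 hd)
  have hU : α ∉ jacobianExponents m q n := fun hmem => hα (by
    rw [formCoeff_tmul, (tmul_topForm_mem_superHarmonics_iff hP hζ h).1 hη.1 α hmem, zero_smul])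
  rw [← hdeg, Finsupp.degree_eq_sum]
  calc ∑ j, α j ≤ ∑ _j : Fin n, (m - 2) := Finset.sum_le_sum fun j _ => by
        by_contra hlt
        exact hU (Or.inl ⟨j, by omega⟩)
    _ = n * (m - 2) := by simp

theorem exists_isGreatest_degrees (hP : IsGenericParams m p q n) {ζ : K}
    (hζ : IsPrimitiveRoot ζ m) : ∃ a b : ℕ,
    IsGreatest {i | superHarmonics (Gmpn K m p n) ⊓ bidegree K n i n ≠ ⊥} a ∧
    IsGreatest {i | superHarmonicsDet (Gmpn K m p n) ⊓ bidegree K n i n ≠ ⊥} b ∧ b < a := by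
  have hw := superHarmonics_bidegree_ne_bot (K := K) hP hζ (witnessExponent_notMem hP)
  have hbdd : BddAbove {i | superHarmonics (Gmpn K m p n) ⊓ bidegree K n i n ≠ ⊥} :=
    ⟨n * (m - 2), fun i hi => le_of_superHarmonics_bidegree_ne_bot hP hζ hi⟩
  refine ⟨_, _, ⟨Nat.sSup_mem ⟨_, hw⟩ hbdd, fun i hi => le_csSup hbdd hi⟩,
    isGreatest_det_degree hP hζ, ?_⟩
  exact (lt_degree_witnessExponent hP).trans_le (le_csSup hbdd hw)

end Conj

/-! ### Sums of distinct natural numbers -/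

/-- The `i`th smallest of `n` distinct natural numbers, counted from 0, is at least `i`. -/
theorem sum_range_le_sum_of_injective {β : Fin n → ℕ} (hβ : Function.Injective β) :
    ∑ i ∈ Finset.range n, i ≤ ∑ i, β i := by
  have hcard : (Finset.univ.image β).card = n := by
    rw [Finset.card_image_of_injective _ hβ, Finset.card_fin]
  have hle : ∀ i : Fin n, (i : ℕ) ≤ (Finset.univ.image β).orderEmbOfFin hcard i := by
    rintro ⟨i, hi⟩
    induction i with
    | zero => exact Nat.zero_le _
    | succ i ih =>
      exact (ih (by omega)).trans_lt (((Finset.univ.image β).orderEmbOfFin hcard).strictMono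
        (Fin.mk_lt_mk.2 (Nat.lt_succ_self i)))
  calc ∑ i ∈ Finset.range n, i = ∑ i : Fin n, (i : ℕ) := Finset.sum_range _
    _ ≤ ∑ i : Fin n, (Finset.univ.image β).orderEmbOfFin hcard i :=
      Finset.sum_le_sum fun i _ => hle i
    _ = ∑ x : (Finset.univ.image β : Finset ℕ), (x : ℕ) :=
      Equiv.sum_comp ((Finset.univ.image β).orderIsoOfFin hcard).toEquiv
        fun x : (Finset.univ.image β : Finset ℕ) => (x : ℕ)
    _ = ∑ x ∈ Finset.univ.image β, x := Finset.sum_coe_sort _ fun x : ℕ => x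
    _ = ∑ i, β i := Finset.sum_image fun _ _ _ _ h => hβ h

/-- A value at least `n` would force all of `0, …, n-1` to occur below it, making `n + 1` values. -/
theorem sum_le_sum_range_of_no_gap {β : Fin n → ℕ} (hβ : Function.Injective β)
    (hgap : ∀ v, (∀ i, β i ≠ v) → ∀ i, β i ≤ v) : ∑ i, β i ≤ ∑ i ∈ Finset.range n, i := by
  have hlt : ∀ i, β i < n := by
    intro i
    by_contra hi
    have hsub : insert (β i) (Finset.range n) ⊆ Finset.univ.image β := by
      intro v hv
      rw [Finset.mem_insert, Finset.mem_range] at hv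
      rcases hv with rfl | hv
      · simp
      · by_contra hnot
        have := hgap v (fun j hj => hnot (by rw [← hj]; simp)) i
        omega
    have := Finset.card_le_card hsub
    rw [Finset.card_insert_of_notMem (by rw [Finset.mem_range]; omega), Finset.card_range,
      Finset.card_image_of_injective _ hβ, Finset.card_fin] at this
    omega
  rw [← Finset.sum_image (f := fun x : ℕ => x) (g := β) fun _ _ _ _ h => hβ h]
  refine Finset.sum_le_sum_of_subset fun x hx => ?_
  obtain ⟨i, -, rfl⟩ := Finset.mem_image.1 hx
  exact Finset.mem_range.2 (hlt i)

/-- A family indexed by exponents that is supported on exponents with distinct entries and is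
annihilated by all elementary symmetric shift operators vanishes at every exponent with a gap. -/
theorem eq_zero_of_gap {b : (Fin n → ℕ) → K}
    (hinj : ∀ β, b β ≠ 0 → Function.Injective β)
    (hsum : ∀ (γ : Fin n → ℕ) (k : ℕ), 0 < k →
      ∑ J ∈ Finset.powersetCard k Finset.univ, b (fun i => γ i + if i ∈ J then 1 else 0) = 0)
    (v : ℕ) : ∀ β : Fin n → ℕ, (∀ i, β i ≠ v) → (∃ i, v < β i) → b β = 0 := by
  induction v using Nat.strong_induction_on with
  | _ v ih =>
    rintro β hv ⟨i₀, hi₀⟩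
    by_contra hne
    have hβ := hinj β hne
    -- Lower by one all entries above the gap `v` to get `γ`. The relation at `γ` of order `|J|`
    -- then has `b β` as its `J` term, and all other terms vanish by induction on `v`.
    set J : Finset (Fin n) := Finset.univ.filter fun i => v < β i with hJ
    have hmemJ : ∀ i, i ∈ J ↔ v < β i := fun i => by simp [hJ]
    set γ : Fin n → ℕ := fun i => β i - if i ∈ J then 1 else 0 with hγ
    have h := hsum γ J.card (Finset.card_pos.2 ⟨i₀, (hmemJ i₀).2 hi₀⟩)
    rw [Finset.sum_eq_single J] at h
    · apply hne
      rw [← h]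
      congr 1
      ext1 i
      simp only [hγ]
      split_ifs with hi
      · have := (hmemJ i).1 hi; omega
      · omega
    · intro J' hJ' hJJ'
      have hcard := (Finset.mem_powersetCard.1 hJ').2
      have hnon : (J' \ J).Nonempty := by
        rw [Finset.sdiff_nonempty]
        intro hsub
        exact hJJ' (Finset.eq_of_subset_of_card_le hsub hcard.ge)
      obtain ⟨k, hk, hmin⟩ := Finset.exists_min_image (J' \ J) β hnon
      rw [Finset.mem_sdiff, hmemJ] at hk
      have hkv : β k < v := by have := hv k; omega
      -- Among the raised entries outside `J`, `k` has the smallest value. Raising it vacates that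
      -- value, giving a gap at `β k < v`, while the entry at `i₀` stays at least `v`.
      refine ih (β k) hkv _ (fun i => ?_) ⟨i₀, ?_⟩
      · simp only [hγ]
        by_cases hi : i ∈ J
        · have := (hmemJ i).1 hi
          rw [if_pos hi]; split_ifs <;> omega
        · rw [if_neg hi]
          split_ifs with hi'
          · have := hmin i (Finset.mem_sdiff.2 ⟨hi', hi⟩); omega
          · intro heq
            have : i = k := hβ (by omega)
            exact hi' (this ▸ hk.1)
      · simp only [hγ]
        rw [if_pos ((hmemJ i₀).2 hi₀)]
        split_ifs <;> omega
    · intro hJ'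
      exact absurd (Finset.mem_powersetCard.2 ⟨Finset.subset_univ _, rfl⟩) hJ'

/-! ### The degree of the Vandermondian -/

/-- The exponent of `∏_{j ∈ J} x_j^m`. -/
def indicatorExponent (m : ℕ) (J : Finset (Fin n)) : Fin n →₀ ℕ :=
  Finsupp.equivFunOnFinite.symm fun i => if i ∈ J then m else 0

theorem indicatorExponent_apply (m : ℕ) (J : Finset (Fin n)) (i : Fin n) :
    indicatorExponent m J i = if i ∈ J then m else 0 := rfl

theorem polyAct_indicatorExponent (hm : 0 < m) {σ : GL (Fin n) K} {π : Equiv.Perm (Fin n)}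
    {a : Fin n → K} (ha : ∀ i, a i ^ m = 1)
    (hσ : (σ : Matrix (Fin n) (Fin n) K) = monomialMatrix π a) (J : Finset (Fin n)) :
    polyAct σ (MvPolynomial.monomial (indicatorExponent m J) (1 : K))
      = MvPolynomial.monomial (indicatorExponent m (J.map π.toEmbedding)) 1 := by
  rw [polyAct_monomial (ne_zero_of_pow_eq_one hm ha) hσ, mul_one]
  congr 1
  · congr 1
    ext i
    rw [Finsupp.mapDomain_equiv_apply, indicatorExponent_apply, indicatorExponent_apply]
    simp only [Finset.mem_map_equiv]
  · refine Finset.prod_eq_one fun i _ => ?_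
    rw [indicatorExponent_apply]
    split_ifs
    · rw [inv_pow, ha, inv_one]
    · rw [pow_zero]

theorem sum_indicatorExponent_mem_coinvariantIdeal (hm : 0 < m) {k : ℕ} (hk : 0 < k) :
    ∑ J ∈ Finset.powersetCard k (Finset.univ : Finset (Fin n)),
      MvPolynomial.monomial (indicatorExponent m J) (1 : K)
        ∈ coinvariantIdeal (Gmpn K m p n) := by
  refine Ideal.subset_span ⟨?_, m * k, Nat.mul_pos hm hk, ?_⟩
  · rintro σ ⟨π, a, ha, -, hσa⟩
    rw [map_sum]
    refine Finset.sum_nbij' (fun J => J.map π.toEmbedding) (fun J => J.map π.symm.toEmbedding)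
      ?_ ?_ ?_ ?_ ?_
    · intro J hJ
      rw [Finset.mem_powersetCard] at hJ ⊢
      exact ⟨Finset.subset_univ _, by rw [Finset.card_map, hJ.2]⟩
    · intro J hJ
      rw [Finset.mem_powersetCard] at hJ ⊢
      exact ⟨Finset.subset_univ _, by rw [Finset.card_map, hJ.2]⟩
    · intro J _; ext x; simp
    · intro J _; ext x; simp
    · intro J _; exact polyAct_indicatorExponent hm ha hσa J
  · refine MvPolynomial.IsHomogeneous.sum _ _ _ fun J hJ =>
      MvPolynomial.isHomogeneous_monomial _ ?_
    rw [Finsupp.degree_eq_sum]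
    simp only [indicatorExponent_apply]
    rw [Finset.sum_ite_mem, Finset.univ_inter, Finset.sum_const,
      (Finset.mem_powersetCard.1 hJ).2, smul_eq_mul, mul_comm]

theorem monomial_constExponent_mem_coinvariantIdeal (hP : IsGenericParams m p q n) :
    MvPolynomial.monomial (constExponent n q) (1 : K) ∈ coinvariantIdeal (Gmpn K m p n) := by
  refine Ideal.subset_span ⟨monomial_constExponent_mem_polyInvariants hP, n * q,
    Nat.mul_pos (by have := hP.two_le_n; omega) hP.q_pos,
    MvPolynomial.isHomogeneous_monomial _ ?_⟩
  rw [Finsupp.degree_eq_sum]; simp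

theorem injective_of_coeff_ne_zero_of_det (hm : 0 < m) {h : MvPolynomial (Fin n) K}
    (hh : ∀ σ ∈ Gmpn K m p n, polyAct σ h = (σ : Matrix (Fin n) (Fin n) K).det • h)
    {α : Fin n →₀ ℕ} (hα : h.coeff α ≠ 0) : Function.Injective α := by
  intro i j hij
  by_contra hne
  obtain ⟨σ, hσ, hσs⟩ := exists_swap_mem (K := K) (p := p) hm i j
  have h1 := coeff_polyAct (fun _ => one_ne_zero) hσs α h
  rw [mapDomain_swap_eq hij, hh σ hσ, hσs, det_monomialMatrix, Equiv.Perm.sign_swap hne,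
    MvPolynomial.coeff_smul] at h1
  simp only [Finset.prod_const_one, Units.val_neg, Units.val_one, Int.cast_neg, Int.cast_one,
    inv_one, one_pow, one_mul, smul_eq_mul, neg_mul] at h1
  exact hα (neg_eq_self.1 h1)

/-- Semi-invariance, together with the annihilation of `Δ` by `∂` of `(x_1 ⋯ x_n)^q`, makes each
exponent of the form `q - 1 + m β`, with `β` injective by the sign under transpositions. The
elementary symmetric polynomials in the `x_i^m` also annihilate `Δ`; on factorially weighted
coefficients they are the shift relations of `eq_zero_of_gap`. So `β` has no gaps and its sum is at
most `0 + ⋯ + (n-1)`. -/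
theorem totalDegree_vandermondian_le [ConjClosed K] (hP : IsGenericParams m p q n) {ζ : K}
    (hζ : IsPrimitiveRoot ζ m) {Δ : MvPolynomial (Fin n) K}
    (hΔ : IsVandermondian (Gmpn K m p n) Δ) :
    Δ.totalDegree ≤ n * (q - 1) + m * ∑ i ∈ Finset.range n, i := by
  have hm := hP.m_pos
  have hqpos := hP.q_pos
  have hdet : ∀ σ ∈ Gmpn K m p n, polyAct σ Δ = (σ : Matrix (Fin n) (Fin n) K).det • Δ :=
    fun σ hσ => by rw [hΔ.1.2 σ hσ, pow_one]
  let ex : (Fin n → ℕ) → (Fin n →₀ ℕ) := fun β =>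
    Finsupp.equivFunOnFinite.symm fun i => q - 1 + m * β i
  have hex : ∀ β i, ex β i = q - 1 + m * β i := fun _ _ => rfl
  have hgap := eq_zero_of_gap (b := fun β => multifactorial K (ex β) * Δ.coeff (ex β))
    (fun β hβ => by
      have h1 := injective_of_coeff_ne_zero_of_det hm hdet (right_ne_zero_of_mul hβ)
      intro i j hij
      exact h1 (by rw [hex, hex, hij]))
    (fun γ k hk => by
      have h1 := hΔ.1.1 _ (sum_indicatorExponent_mem_coinvariantIdeal hm hk)
      rw [polyDiff_sum, LinearMap.sum_apply] at h1
      have h2 := congrArg (fun f => multifactorial K (ex γ) * f.coeff (ex γ)) h1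
      simp only [MvPolynomial.coeff_sum, Finset.mul_sum, polyDiff_monomial_one,
        multifactorial_mul_coeff_polyDiffMonomial, MvPolynomial.coeff_zero, mul_zero] at h2
      rw [← h2]
      refine Finset.sum_congr rfl fun J _ => ?_
      have : ex (fun i => γ i + if i ∈ J then 1 else 0) = ex γ + indicatorExponent m J := by
        ext i
        rw [Finsupp.add_apply, hex, hex, indicatorExponent_apply]
        split_ifs <;> ring
      rw [this])
  rw [MvPolynomial.totalDegree]
  refine Finset.sup_le fun α hα => ?_
  rw [MvPolynomial.mem_support_iff] at hα
  obtain ⟨h1, h2⟩ := exponents_of_semiinvariant hP hζ hΔ.1.2 hα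
  -- Since also `q ∣ α i₀ + 1`, this entry is `q - 1`, which fixes the residue of all entries modulo
  -- `m`.
  obtain ⟨i₀, hi₀⟩ : ∃ i, α i < q := by
    by_contra! hall
    have h3 := hΔ.1.1 _ (monomial_constExponent_mem_coinvariantIdeal hP)
    rw [polyDiff_monomial_one] at h3
    exact hα (coeff_eq_zero_of_polyDiffMonomial_eq_zero h3 fun i => hall i)
  have hge : ∀ i, q ≤ α i + 1 := fun i => Nat.le_of_dvd (Nat.succ_pos _) (h2 i)
  have hi₀' : α i₀ = q - 1 := by have := hge i₀; omega
  have hβ : ∀ i, ∃ c : ℕ, α i = q - 1 + m * c := by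
    intro i
    have h3 := h1 i i₀
    rw [hi₀', ← Nat.cast_sub (by have := hge i; omega), Int.natCast_dvd_natCast] at h3
    obtain ⟨c, hc⟩ := h3
    exact ⟨c, by have := hge i; omega⟩
  choose β hβ using hβ
  have hαex : α = ex β := by ext i; rw [hβ, hex]
  have hβinj : Function.Injective β := by
    intro i j hij
    exact injective_of_coeff_ne_zero_of_det hm hdet hα (by rw [hβ, hβ, hij])
  have hsum := sum_le_sum_range_of_no_gap hβinj fun v hv i => by
    by_contra hlt
    have h4 := hgap v β hv ⟨i, by omega⟩
    rw [← hαex] at h4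
    exact hα ((mul_eq_zero.1 h4).resolve_left (multifactorial_ne_zero α))
  calc (α.sum fun _ e => e) = ∑ i, α i := Finsupp.sum_fintype _ _ fun _ => rfl
    _ = n * (q - 1) + m * ∑ i, β i := by
      simp only [hβ, Finset.sum_add_distrib, Finset.mul_sum]; simp
    _ ≤ _ := by gcongr

/-! ### The sum of the co-exponents -/

theorem commute_dX_of_mem_operatorAlgebra {P : Module.End K (Forms K n)}
    (hP : P ∈ operatorAlgebra K n) (j : Fin n) : Commute (dX j) P := by
  have hle : operatorAlgebra K n ≤ Subalgebra.centralizer K {dX j} := by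
    refine Algebra.adjoin_le ?_
    rintro _ (⟨i, rfl⟩ | ⟨i, rfl⟩)
    · rw [SetLike.mem_coe, Subalgebra.mem_centralizer_iff]
      rintro _ rfl
      exact dX_comm j i
    · rw [SetLike.mem_coe, Subalgebra.mem_centralizer_iff]
      rintro _ rfl
      refine TensorProduct.ext' fun h ξ => ?_
      simp only [Module.End.mul_apply, LinearMap.mulLeft_apply, theta,
        Algebra.TensorProduct.tmul_mul_tmul, one_mul, dX_tmul]
  exact (Subalgebra.mem_centralizer_iff K).1 (hle hP) _ rfl

/-- Left multiplications by `θ_i` and the `∂_{x_i}` commute with right multiplication by `1 ⊗ ξ`, so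
such an operator is determined by its values on 0-forms. -/
theorem apply_tmul_of_mem_operatorAlgebra {P : Module.End K (Forms K n)}
    (hP : P ∈ operatorAlgebra K n) (h : MvPolynomial (Fin n) K)
    (ξ : ExteriorAlgebra K (Fin n → K)) :
    P (h ⊗ₜ[K] ξ) = P (h ⊗ₜ[K] 1) * (1 ⊗ₜ[K] ξ) := by
  have hle : operatorAlgebra K n
      ≤ Subalgebra.centralizer K {LinearMap.mulRight K ((1 : MvPolynomial (Fin n) K) ⊗ₜ[K] ξ)} := by
    refine Algebra.adjoin_le ?_
    rintro _ (⟨i, rfl⟩ | ⟨i, rfl⟩)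
    · rw [SetLike.mem_coe, Subalgebra.mem_centralizer_iff]
      rintro _ rfl
      refine TensorProduct.ext' fun h ξ => ?_
      simp only [Module.End.mul_apply, LinearMap.mulRight_apply,
        Algebra.TensorProduct.tmul_mul_tmul, mul_one, dX_tmul]
    · rw [SetLike.mem_coe, Subalgebra.mem_centralizer_iff]
      rintro _ rfl
      refine LinearMap.ext fun x => ?_
      simp only [Module.End.mul_apply, LinearMap.mulRight_apply, LinearMap.mulLeft_apply,
        mul_assoc]
  have := LinearMap.congr_fun ((Subalgebra.mem_centralizer_iff K).1 (hle hP) _ rfl) (h ⊗ₜ[K] 1)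
  simp only [Module.End.mul_apply, LinearMap.mulRight_apply,
    Algebra.TensorProduct.tmul_mul_tmul, mul_one, one_mul] at this
  exact this.symm

theorem exists_monomial_apply_ne_zero {P : Module.End K (Forms K n)}
    (hP : P ∈ operatorAlgebra K n) (hne : P ≠ 0) :
    ∃ α : Fin n →₀ ℕ, P (MvPolynomial.monomial α 1 ⊗ₜ[K] 1) ≠ 0 := by
  by_contra! h0
  apply hne
  refine (formsBasis K n).ext fun ⟨α, I⟩ => ?_
  rw [formsBasis_apply, apply_tmul_of_mem_operatorAlgebra hP, h0, zero_mul, LinearMap.zero_apply]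

theorem list_prod_apply_bidegree {d : Fin n → Module.End K (Forms K n)} {e : Fin n → ℕ}
    (h1 : ∀ i a k, ∀ η ∈ bidegree K n (a + e i) k, d i η ∈ bidegree K n a (k + 1))
    (h2 : ∀ i a k, a < e i → ∀ η ∈ bidegree K n a k, d i η = 0) (l : List (Fin n)) {a k : ℕ}
    {η : Forms K n} (hη : η ∈ bidegree K n a k) :
    (l.map d).prod η ∈ bidegree K n (a - (l.map e).sum) (k + l.length) ∧
      (a < (l.map e).sum → (l.map d).prod η = 0) := by
  induction l with
  | nil => simpa using hη
  | cons i l ih =>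
    obtain ⟨ih1, ih2⟩ := ih
    simp only [List.map_cons, List.prod_cons, Module.End.mul_apply, List.sum_cons,
      List.length_cons]
    by_cases ha : a < (l.map e).sum
    · rw [ih2 ha, map_zero]
      exact ⟨zero_mem _, fun _ => rfl⟩
    by_cases hb : a - (l.map e).sum < e i
    · rw [h2 _ _ _ hb _ ih1]
      exact ⟨zero_mem _, fun _ => rfl⟩
    · refine ⟨?_, fun h => by omega⟩
      rw [show a - (l.map e).sum = a - (e i + (l.map e).sum) + e i by omega] at ih1
      exact h1 _ _ _ _ ih1

theorem eq_C_of_pderiv_eq_zero {h : MvPolynomial (Fin n) K}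
    (hh : ∀ j, MvPolynomial.pderiv j h = 0) : h = MvPolynomial.C (h.coeff 0) := by
  ext α
  rw [MvPolynomial.coeff_C]
  split_ifs with hα
  · rw [hα]
  · obtain ⟨j, hj⟩ := Finsupp.ne_iff.1 (Ne.symm hα)
    have h1 := MvPolynomial.coeff_pderiv (i := j) h (α - Finsupp.single j 1)
    rw [hh, MvPolynomial.coeff_zero, tsub_add_cancel_of_le (by
      rw [Finsupp.single_le_iff]; exact Nat.one_le_iff_ne_zero.2 hj)] at h1
    have h2 := (mul_eq_zero.1 h1.symm).resolve_right (Nat.cast_add_one_ne_zero _)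
    rw [h2]

/-- An equivariant operator in `K[∂_x, θ]` of bidegree `(-N, n)` sends some monomial of degree
`N` to a non-zero multiple of `θ_1 ⋯ θ_n`. -/
theorem exists_monomial_apply_eq_topForm {P : Module.End K (Forms K n)} {N : ℕ}
    (hP : P ∈ operatorAlgebra K n) (hne : P ≠ 0)
    (h1 : ∀ a, ∀ η ∈ bidegree K n a 0, P η ∈ bidegree K n (a - N) n ∧ (a < N → P η = 0)) :
    ∃ (α : Fin n →₀ ℕ) (c : K), α.degree = N ∧ c ≠ 0 ∧
      P (MvPolynomial.monomial α 1 ⊗ₜ[K] 1) = (MvPolynomial.C c : MvPolynomial (Fin n) K) ⊗ₜ[K] topForm K n := by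
  classical
  have hex : ∃ M, ∃ α : Fin n →₀ ℕ, α.degree = M ∧
      P (MvPolynomial.monomial α 1 ⊗ₜ[K] 1) ≠ 0 := by
    obtain ⟨α, hα⟩ := exists_monomial_apply_ne_zero hP hne
    exact ⟨_, α, rfl, hα⟩
  obtain ⟨α, hdeg, hα⟩ := Nat.find_spec hex
  have hmin : ∀ β : Fin n →₀ ℕ, β.degree < α.degree →
      P (MvPolynomial.monomial β 1 ⊗ₜ[K] 1) = 0 := by
    intro β hβ
    by_contra h0
    exact Nat.find_min hex (hdeg ▸ hβ) ⟨β, rfl, h0⟩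
  obtain ⟨hb, hb0⟩ := h1 _ _ (tmul_mem_bidegree (k := 0)
    (MvPolynomial.isHomogeneous_monomial (1 : K) (rfl : α.degree = α.degree))
    (Submodule.one_le.1 (by rw [ExteriorAlgebra.exteriorPower, pow_zero])))
  obtain ⟨h, hh⟩ := exists_eq_tmul_topForm (bidegree_le_thetaDegree _ _ hb)
  -- `P` commutes with `∂_{x_j}`, and it kills the derivatives of `x^α` because `α` has minimal
  -- degree among monomials not killed.
  have hpd : ∀ j, MvPolynomial.pderiv j h = 0 := by
    intro j
    refine tmul_topForm_injective ?_
    rw [TensorProduct.zero_tmul, ← dX_tmul, ← hh, ← Module.End.mul_apply,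
      (commute_dX_of_mem_operatorAlgebra hP j).eq, Module.End.mul_apply, dX_tmul,
      MvPolynomial.pderiv_monomial, one_mul]
    by_cases hj : α j = 0
    · rw [hj, Nat.cast_zero, map_zero, TensorProduct.zero_tmul, map_zero]
    · have hle : Finsupp.single j 1 ≤ α := by
        rw [Finsupp.single_le_iff]; exact Nat.one_le_iff_ne_zero.2 hj
      have hlt : (α - Finsupp.single j 1).degree < α.degree := by
        conv_rhs => rw [← tsub_add_cancel_of_le hle, map_add, Finsupp.degree_single]
        omega
      have h2 := hmin _ hlt
      rw [← mul_one ((α j : ℕ) : K), ← smul_eq_mul, ← MvPolynomial.smul_monomial,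
        ← TensorProduct.smul_tmul', map_smul, h2, smul_zero]
  have hC := eq_C_of_pderiv_eq_zero hpd
  have hc : h.coeff 0 ≠ 0 := by
    intro h0
    rw [h0, map_zero] at hC
    rw [hh, hC, TensorProduct.zero_tmul] at hα
    exact hα rfl
  refine ⟨α, h.coeff 0, ?_, hc, by rw [← hC, hh]⟩
  have hge : N ≤ α.degree := by
    by_contra hlt
    exact hα (hb0 (by omega))
  by_contra hN
  rw [hh] at hb
  have h3 := (formCoeff_mem_of_mem_bidegree hb 0).2 (by rw [map_zero]; omega)
  rw [formCoeff_tmul] at h3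
  exact hc ((smul_eq_zero.1 h3).resolve_right topForm_ne_zero)

/-- Elements fixing the exponent `α` must act on `x^α` by `det⁻¹`, the character of the top form.
Transpositions force distinct entries; diagonal matrices force `α_i ≡ α_j` modulo `m` and `q ∣ α_i -
1`. Hence the quotients `α_i / m` are distinct, and the remainders are positive unless `q = 1`. -/
theorem le_degree_of_equivariant (hP : IsGenericParams m p q n) {ζ : K}
    (hζ : IsPrimitiveRoot ζ m) {P : Module.End K (Forms K n)}
    (hPG : ∀ σ ∈ Gmpn K m p n, ∀ η, P (formAct σ η) = formAct σ (P η)) {α : Fin n →₀ ℕ} {c : K}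
    (hc : c ≠ 0)
    (hα : P (MvPolynomial.monomial α 1 ⊗ₜ[K] 1) = (MvPolynomial.C c : MvPolynomial (Fin n) K) ⊗ₜ[K] topForm K n) :
    (n * if q = 1 then 0 else 1) + m * ∑ i ∈ Finset.range n, i ≤ α.degree := by
  have hm := hP.m_pos
  have key : ∀ σ ∈ Gmpn K m p n, ∀ (π : Equiv.Perm (Fin n)) (a : Fin n → K),
      (∀ i, a i ≠ 0) → (σ : Matrix (Fin n) (Fin n) K) = monomialMatrix π a →
      α.mapDomain π = α →
      ∏ i, (a i)⁻¹ ^ α i = (∏ i, (a i)⁻¹) * ((Equiv.Perm.sign π : ℤ) : K) := by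
    intro σ hσ π a ha hσa hπ
    have h1 := hPG σ hσ (MvPolynomial.monomial α 1 ⊗ₜ[K] 1)
    rw [hα, formAct_tmul_topForm ha hσa, formAct, Algebra.TensorProduct.map_tmul, map_one (ExteriorAlgebra.map _),
      polyAct_monomial ha hσa, hπ, ← smul_eq_mul (_ : K) (1 : K), ← MvPolynomial.smul_monomial,
      ← TensorProduct.smul_tmul', map_smul, hα, ← MvPolynomial.algebraMap_eq,
      AlgHom.commutes] at h1
    have h2 := congrArg (formCoeff 0) h1
    rw [map_smul, map_smul, formCoeff_tmul] at h2
    refine smul_left_injective K (smul_ne_zero ?_ topForm_ne_zero) h2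
    simpa [MvPolynomial.algebraMap_eq] using hc
  have hinj : Function.Injective α := by
    intro i j hij
    by_contra hne
    obtain ⟨σ, hσ, hσs⟩ := exists_swap_mem (K := K) (p := p) hm i j
    have h1 := key σ hσ _ _ (fun _ => one_ne_zero) hσs (mapDomain_swap_eq hij)
    rw [Equiv.Perm.sign_swap hne] at h1
    simp only [inv_one, one_pow, Finset.prod_const_one, Units.val_neg, Units.val_one,
      Int.cast_neg, Int.cast_one, one_mul] at h1
    exact one_ne_zero (self_eq_neg.1 h1)
  obtain ⟨h1, h2⟩ := exponents_of_trivial_character (δ := fun i => (α i : ℤ) - 1) hP hζ (by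
    intro a ha ha'
    obtain ⟨σ, hσ, hσa⟩ := exists_mem_Gmpn hm 1 ha ha'
    have hne := ne_zero_of_pow_eq_one hm ha
    have h1 := key σ hσ _ _ hne hσa (by rw [Equiv.Perm.coe_one, Finsupp.mapDomain_id])
    rw [Equiv.Perm.sign_one, Units.val_one, Int.cast_one, mul_one] at h1
    have h3 : ∏ i, a i ≠ 0 := Finset.prod_ne_zero_iff.2 fun i _ => hne i
    simp only [inv_pow, Finset.prod_inv_distrib, inv_inj] at h1
    simp only [zpow_sub_one₀ (hne _), zpow_natCast, Finset.prod_mul_distrib, h1,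
      Finset.prod_inv_distrib]
    exact mul_inv_cancel₀ h3)
  have hmod : ∀ i j, α i % m = α j % m := by
    intro i j
    have := h1 i j
    rw [sub_sub_sub_cancel_right] at this
    exact (Nat.modEq_iff_dvd.2 this).symm
  have hβ : Function.Injective fun i => α i / m := by
    intro i j hij
    refine hinj ?_
    rw [← Nat.mod_add_div (α i) m, ← Nat.mod_add_div (α j) m, hmod i j]
    exact congrArg _ (congrArg _ hij)
  have hone : ∀ i, (if q = 1 then 0 else 1) ≤ α i % m := by
    intro i
    split_ifs with hq
    · exact Nat.zero_le _
    · by_contra h0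
      -- A zero remainder makes `q` divide both `α i` and `α i - 1`, hence 1.
      have h3 : m ∣ α i := Nat.dvd_of_mod_eq_zero (by omega)
      have h4 : (q : ℤ) ∣ α i := Int.natCast_dvd_natCast.2
        ((Dvd.intro_left p hP.eq_mul.symm).trans h3)
      have h5 := dvd_sub h4 (h2 i)
      rw [sub_sub_cancel] at h5
      exact hq (by exact_mod_cast Int.eq_one_of_dvd_one (by omega) h5)
  rw [Finsupp.degree_eq_sum]
  calc (n * if q = 1 then 0 else 1) + m * ∑ i ∈ Finset.range n, i
      ≤ ∑ i, α i % m + m * ∑ i, α i / m := by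
        refine add_le_add ?_ (Nat.mul_le_mul_left m (sum_range_le_sum_of_injective hβ))
        calc (n * if q = 1 then 0 else 1) = ∑ _i : Fin n, (if q = 1 then 0 else 1) := by simp
          _ ≤ _ := Finset.sum_le_sum fun i _ => hone i
    _ = ∑ i, α i := by
      rw [Finset.mul_sum, ← Finset.sum_add_distrib]
      exact Finset.sum_congr rfl fun i _ => Nat.mod_add_div _ _

/-- The product `d_1 ⋯ d_n` is one of the linearly independent operators, hence non-zero, and it
lowers `x`-degree by the sum of the co-exponents. It therefore sends some monomial of exactly that
degree to a multiple of the top form. -/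
theorem le_sum_coexponents [ConjClosed K] (hP : IsGenericParams m p q n) {ζ : K}
    (hζ : IsPrimitiveRoot ζ m) {f : Fin n → MvPolynomial (Fin n) K}
    {d : Fin n → Module.End K (Forms K n)} {e : Fin n → ℕ}
    (hd : IsGeneralizedExteriorDerivatives (Gmpn K m p n) f d e) :
    (n * if q = 1 then 0 else 1) + m * ∑ i ∈ Finset.range n, i ≤ ∑ i, e i := by
  set l : List (Fin n) := (Finset.univ : Finset (Fin n)).sort (· ≤ ·) with hl
  have hlen : l.length = n := by rw [hl, Finset.length_sort, Finset.card_fin]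
  have hsum : (l.map e).sum = ∑ i, e i := by
    rw [← List.sum_toFinset _ (Finset.sort_nodup _ _), Finset.sort_toFinset]
  have hne : (l.map d).prod ≠ 0 := by
    have := hd.linearIndependent.ne_zero ((0 : Fin n →₀ ℕ), (Finset.univ : Finset (Fin n)))
    simpa [operatorMonomial] using this
  have hmem : (l.map d).prod ∈ operatorAlgebra K n := by
    refine Subalgebra.list_prod_mem _ fun P hPm => ?_
    obtain ⟨i, -, rfl⟩ := List.mem_map.1 hPm
    exact (hd.equivariant i).1
  obtain ⟨α, c, hdeg, hc, hα⟩ := exists_monomial_apply_eq_topForm (N := ∑ i, e i) hmem hne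
    fun a η hη => by
      have := list_prod_apply_bidegree hd.map_bidegree hd.map_low_degree l hη
      rwa [hsum, hlen, zero_add] at this
  rw [← hdeg]
  refine le_degree_of_equivariant hP hζ (P := (l.map d).prod) (fun σ hσ η => ?_) hc hα
  exact list_prod_apply_formAct (fun P hPm => by
    obtain ⟨i, -, rfl⟩ := List.mem_map.1 hPm
    exact hd.equivariant i) hσ η

theorem not_bidegree_bound [ConjClosed K] (hP : IsGenericParams m p q n) {ζ : K}
    (hζ : IsPrimitiveRoot ζ m) {f : Fin n → MvPolynomial (Fin n) K}
    {d : Fin n → Module.End K (Forms K n)} {e : Fin n → ℕ}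
    (hd : IsGeneralizedExteriorDerivatives (Gmpn K m p n) f d e) {Δ : MvPolynomial (Fin n) K}
    (hΔ : IsVandermondian (Gmpn K m p n) Δ) :
    ¬ ∀ i : ℕ, superHarmonics (Gmpn K m p n) ⊓ bidegree K n i n ≠ ⊥ ↔
      (i : ℤ) ≤ (Δ.totalDegree : ℤ) - ∑ j, (e j : ℤ) := by
  intro H
  have h1 := (H _).1 (superHarmonics_bidegree_ne_bot hP hζ (witnessExponent_notMem hP))
  have h2 := totalDegree_vandermondian_le hP hζ hΔ
  have h3 := le_sum_coexponents hP hζ hd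
  have h4 := lt_degree_witnessExponent hP
  -- The case distinction in the co-exponent estimate is exactly the truncation of `q - 2` at `q =
  -- 1`, so the proposed bound is at most `n * (q - 2)`.
  have h5 : n * (q - 1) = n * (q - 2) + n * if q = 1 then 0 else 1 := by
    rw [← mul_add]
    have := hP.q_pos
    congr 1
    split_ifs <;> omega
  rw [← Nat.cast_sum] at h1
  omega

theorem isGenericParams_of_not_exceptional (hm : 0 < m) (hp : 0 < p) (hn : 0 < n)
    (hpm : p ∣ m) (h22n : ¬ (m = 2 ∧ p = 2)) (hmp1 : ¬ n = 1) (hmm2 : ¬ (p = m ∧ n = 2))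
    (hm1n : ¬ p = 1) : IsGenericParams m p (m / p) n where
  eq_mul := (Nat.mul_div_cancel' hpm).symm
  q_pos := Nat.div_pos (Nat.le_of_dvd hm hpm) hp
  two_le_p := by omega
  three_le_m := by have := Nat.le_of_dvd hm hpm; omega
  two_le_n := by omega
  three_le_n := fun h => by
    have := Nat.mul_div_cancel' hpm
    rw [h] at this
    omega

end SuperHarmonics
end

open SuperHarmonics
theorem mainTheorem9 (K : Subfield ℂ) [ConjClosed K] (m p n : ℕ)
    (hm : 0 < m) (hp : 0 < p) (hn : 0 < n) (hpm : p ∣ m)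
    -- `K` contains the entries of the matrices in `G(m, p, n)`
    (hroots : ∀ z : ℂ, z ^ m = 1 → z ∈ K)
    -- the excluded families
    (h11n : ¬ (m = 1 ∧ p = 1)) (h21n : ¬ (m = 2 ∧ p = 1)) (h22n : ¬ (m = 2 ∧ p = 2))
    (hmp1 : ¬ n = 1) (hmm2 : ¬ (p = m ∧ n = 2)) (hm1n : ¬ p = 1)
    (G : Subgroup (GL (Fin n) K)) (hG : G = Gmpn K m p n)
    (r : ℕ) (hr : r = groupRank G) :
    -- `r = n`
    r = n ∧
    -- `Γ_G` exists, and `Ann Γ_G ≠ I'_G`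
    (∃ Γ, IsGammaElement G Γ) ∧
    (∀ f, IsBasicInvariants G f → ∀ Γ, IsGammaElement G Γ →
      annihilatorSet Γ ≠ (jacobianIdeal f : Set (MvPolynomial (Fin n) K))) ∧
    -- the `r`-form component of `SH_G = K[∂] SH_G^det` fails
    superHarmonics G ⊓ thetaDegree K n r ≠
      derivativeClosure (superHarmonicsDet G ⊓ thetaDegree K n r) ∧
    -- the `r`-form component of `SH_G = {∂_g d_{i_1} ⋯ d_{i_k} Δ_G}` fails
    (∀ f, IsBasicInvariants G f → ∀ d e, IsGeneralizedExteriorDerivatives G f d e →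
      ∀ Δ, IsVandermondian G Δ →
        ((superHarmonics G ⊓ thetaDegree K n r : Submodule K (Forms K n)) : Set (Forms K n)) ≠
          {ξ | ∃ (g : MvPolynomial (Fin n) K) (s : Fin r → Fin n),
            ξ = formDiff (g ⊗ₜ[K] 1) ((List.ofFn fun j => d (s j)).prod (Δ ⊗ₜ[K] 1))}) ∧
    -- the top `x`-degree of `SH_G^r` is larger than that of its `det`-isotypic part
    (∃ a b : ℕ,
      IsGreatest {i | superHarmonics G ⊓ bidegree K n i r ≠ ⊥} a ∧
      IsGreatest {i | superHarmonicsDet G ⊓ bidegree K n i r ≠ ⊥} b ∧ b < a) ∧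
    -- the `r`-form component of the bi-degree bound fails
    (∀ f, IsBasicInvariants G f → ∀ d e, IsGeneralizedExteriorDerivatives G f d e →
      ∀ Δ, IsVandermondian G Δ →
        ¬ ∀ i : ℕ, superHarmonics G ⊓ bidegree K n i r ≠ ⊥ ↔
          (i : ℤ) ≤ (Δ.totalDegree : ℤ) - ∑ j, (e j : ℤ)) := by
  have hP := isGenericParams_of_not_exceptional hm hp hn hpm h22n hmp1 hmm2 hm1n
  obtain ⟨ζ, hζ⟩ := exists_primitiveRoot_mem hm hroots
  have hrn : r = n := by rw [hr, hG, groupRank_eq hP hζ]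
  clear hr
  subst hG hrn
  exact ⟨rfl, ⟨_, isGammaElement_monomial hP hζ⟩,
    fun f hf Γ hΓ => annihilatorSet_ne_jacobianIdeal hP hζ hf hΓ,
    superHarmonics_ne_derivativeClosure hP hζ,
    fun f hf d e hd Δ hΔ => superHarmonics_ne_derivatives hP hζ hd hΔ,
    exists_isGreatest_degrees hP hζ,
    fun f hf d e hd Δ hΔ => not_bidegree_bound hP hζ hd hΔ⟩
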